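/- Let $k \to R$ be a map of animated (i.e. simplicial) commutative rings; for instance $k=\mathbf{Z}$ or $k=R$. Let $\mathrm{CAlg}_R$ be the $\infty$-category of animated commutative $R$-algebras, i.e. simplicial commutative $R$-algebras up to weak equivalence. For $S \in \mathrm{CAlg}_R$ let $HH(S) = HH(S/k)$ be its derived Hochschild homology over $k$, i.e. the Hochschild complex $[n] \mapsto Q^{\otimes_k (n+1)}$ of a resolution $Q \to S$ by a simplicial commutative $k$-algebra that is polynomial in each degree, with its circle action (Connes' operator $B$). Let $HC(S) = HH(S)_{hS^1}$, $HC^-(S) = HH(S)^{hS^1}$ and $HP(S) = HH(S)^{tS^1}$ be cyclic, negative cyclic and periodic cyclic homology, computed by the complexes $M[u^{-1}]$, $M[[u]]$ and $M((u))$ with differential $b + uB$, where $M$ is the mixed complex of $Q$, and let $\mathrm{can} \colon HC^- \to HP$ be the canonical map. All of these are functors from $\mathrm{CAlg}_R$ to the derived $\infty$-category $\mathbf{D}(\mathbf{Z})$ of abelian groups. Call a functor $G \colon \mathrm{CAlg}_R \to \mathbf{D}(\mathbf{Z})$ $\mathbf{A}^1$-invariant if $G(S) \to G(S[t])$ is an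 equivalence for all $S \in \mathrm{CAlg}_R$, and let $L_{\mathbf{A}^1}$ be the reflection of functors $\mathrm{CAlg}_R \to \mathbf{D}(\mathbf{Z})$ onto the $\mathbf{A}^1$-invariant ones. A map $X \to Y$ is an $L_{\mathbf{A}^1}$-equivalence if $\mathrm{Hom}(Y, G) \to \mathrm{Hom}(X, G)$ is bijective for all $\mathbf{A}^1$-invariant $G$. **Theorem (Geller–Weibel).** $L_{\mathbf{A}^1} HH = 0$ and $L_{\mathbf{A}^1} HC = 0$, that is, the maps $HH \to 0$ and $HC \to 0$ exhibit $0$ as the $\mathbf{A}^1$-localizations of $HH$ and $HC$. The canonical map $\mathrm{can} \colon HC^- \to HP$ is an $L_{\mathbf{A}^1}$-equivalence. -/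

import Mathlib

open CategoryTheory Limits
open scoped ZeroObject

universe u v

namespace A1

section Bar
variable {D : Type u} [Category.{v} D] (T : Comonad D)

/-- The iterate `T^n A`. -/
def barObj (A : D) : ℕ → D
  | 0 => A
  | n + 1 => T.obj (barObj A n)

/-- `ε T^n`. -/
def barCounit (A : D) (n : ℕ) : barObj T A (n + 1) ⟶ barObj T A n :=
  T.ε.app (barObj T A n)

/-- `δ T^n`. -/
def barComult (A : D) (n : ℕ) : barObj T A (n + 1) ⟶ barObj T A (n + 2) :=
  T.δ.app (barObj T A n)

/-- The action of `T` on morphisms between iterates of `T`. -/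
def barLift {A A' : D} {m n : ℕ} (f : barObj T A m ⟶ barObj T A' n) :
    barObj T A (m + 1) ⟶ barObj T A' (n + 1) :=
  T.map f

lemma barLift_id (A : D) (n : ℕ) : barLift T (𝟙 (barObj T A n)) = 𝟙 _ := T.map_id _

lemma barLift_comp {A A' A'' : D} {m n p : ℕ} (f : barObj T A m ⟶ barObj T A' n)
    (g : barObj T A' n ⟶ barObj T A'' p) : barLift T (f ≫ g) = barLift T f ≫ barLift T g :=
  T.map_comp _ _

lemma barLift_counit {A A' : D} {m n : ℕ} (f : barObj T A m ⟶ barObj T A' n) :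
    barLift T f ≫ barCounit T A' n = barCounit T A m ≫ f := T.ε.naturality f

lemma barLift_comult {A A' : D} {m n : ℕ} (f : barObj T A m ⟶ barObj T A' n) :
    barLift T f ≫ barComult T A' n = barComult T A m ≫ barLift T (barLift T f) :=
  T.δ.naturality f

lemma barComult_counit (A : D) (n : ℕ) : barComult T A n ≫ barCounit T A (n + 1) = 𝟙 _ :=
  T.left_counit _

lemma barComult_lift_counit (A : D) (n : ℕ) :
    barComult T A n ≫ barLift T (barCounit T A n) = 𝟙 _ :=
  T.right_counit _

lemma barComult_coassoc (A : D) (n : ℕ) :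
    barComult T A n ≫ barLift T (barComult T A n) = barComult T A n ≫ barComult T A (n + 1) :=
  T.coassoc _

/-- Drop the first point of the source. -/
def tailHom {a b : ℕ} (f : Fin (a + 1) →o Fin b) : Fin a →o Fin b where
  toFun i := f i.succ
  monotone' _ _ h := f.monotone (Fin.succ_le_succ_iff.2 h)

/-- Drop the first point of the target, if it is not a value. -/
def predHom {a b : ℕ} (f : Fin a →o Fin (b + 1)) (h : ∀ i, f i ≠ 0) : Fin a →o Fin b where
  toFun i := (f i).pred (h i)
  monotone' _ _ hij := Fin.pred_le_pred_iff.2 (f.monotone hij)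

lemma ne_zero_of_head {a b : ℕ} (f : Fin (a + 1) →o Fin (b + 1)) (h : f 0 ≠ 0) (i : Fin (a + 1)) :
    f i ≠ 0 := by
  intro h0
  apply h
  have := f.monotone (Fin.zero_le i)
  rw [h0] at this
  exact le_antisymm this (Fin.zero_le _)

/-- A comonad is a comonoid for the composition of endofunctors, so that a monotone map
`f : {0, …, a - 1} → {0, …, b - 1}` acts as `T^b ⟶ T^a`: the `j`-th factor `T` is sent to `T^r`
by the iterated comultiplication (the counit if `r = 0`), `r` being the size of the fibre of `f`
over `j`. -/
def barMap (A : D) : ∀ (a b : ℕ) (_ : Fin a →o Fin b), (barObj T A b ⟶ barObj T A a)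
  | 0, 0, _ => 𝟙 _
  | 0, b + 1, f => barCounit T A b ≫ barMap A 0 b (predHom f (fun i => i.elim0))
  | _ + 1, 0, f => (f 0).elim0
  | a + 1, b + 1, f =>
      if h : f 0 = 0 then barComult T A b ≫ barLift T (barMap A a (b + 1) (tailHom f))
      else barCounit T A b ≫ barMap A (a + 1) b (predHom f (ne_zero_of_head f h))
termination_by a b => a + b

lemma barMap_skip (A : D) (a b : ℕ) (f : Fin a →o Fin (b + 1)) (h : ∀ i, f i ≠ 0) :
    barMap T A a (b + 1) f = barCounit T A b ≫ barMap T A a b (predHom f h) := by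
  cases a with
  | zero => rw [barMap]
  | succ a => rw [barMap, dif_neg (h 0)]

lemma barMap_head (A : D) (a b : ℕ) (f : Fin (a + 1) →o Fin (b + 1)) (h : f 0 = 0) :
    barMap T A (a + 1) (b + 1) f =
      barComult T A b ≫ barLift T (barMap T A a (b + 1) (tailHom f)) := by
  rw [barMap, dif_pos h]

lemma barMap_id (A : D) (a : ℕ) : barMap T A a a OrderHom.id = 𝟙 _ := by
  induction a with
  | zero => rw [barMap]
  | succ a ih =>
    rw [barMap_head T A a a _ rfl,
      barMap_skip T A a a (tailHom OrderHom.id) (fun i => Fin.succ_ne_zero i)]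
    have h : predHom (tailHom (OrderHom.id : Fin (a + 1) →o Fin (a + 1)))
        (fun i => Fin.succ_ne_zero i) = OrderHom.id := by
      ext i; simp [predHom, tailHom]
    rw [h, ih, Category.comp_id, barComult_lift_counit]

lemma barMap_comp (A : D) (a b c : ℕ) (g : Fin a →o Fin b) (f : Fin b →o Fin c) :
    barMap T A a c (f.comp g) = barMap T A b c f ≫ barMap T A a b g := by
  induction hN : a + b + c using Nat.strong_induction_on generalizing a b c with
  | _ N ih =>
  subst hN
  cases c with
  | zero =>
    cases b with
    | succ b => exact (f 0).elim0
    | zero =>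
      cases a with
      | succ a => exact (g 0).elim0
      | zero =>
        have : barMap T A 0 0 f = 𝟙 _ := by rw [barMap]
        rw [this, Category.id_comp]
        congr 1
        ext i; exact i.elim0
  | succ c =>
    by_cases hf : ∀ i, f i ≠ 0
    · have hfg : ∀ i, (f.comp g) i ≠ 0 := fun i => hf (g i)
      have h3 := ih (a + b + c) (by omega) a b c g (predHom f hf) rfl
      have h4 : predHom (f.comp g) hfg = (predHom f hf).comp g := rfl
      rw [barMap_skip T A b c f hf, barMap_skip T A a c (f.comp g) hfg, Category.assoc, h4, h3]
    · cases b with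
      | zero => exact absurd (fun i : Fin 0 => i.elim0) hf
      | succ b =>
        have hf0 : f 0 = 0 := by
          by_contra h
          exact hf (ne_zero_of_head f h)
        by_cases hg : ∀ i, g i ≠ 0
        · have h3 := ih (a + b + (c + 1)) (by omega) a b (c + 1) (predHom g hg) (tailHom f) rfl
          have h4 : (tailHom f).comp (predHom g hg) = f.comp g := by
            ext i
            change ((f (((g i).pred (hg i)).succ) : Fin (c + 1)) : ℕ) = f (g i)
            rw [Fin.succ_pred]
          rw [barMap_skip T A a b g hg, barMap_head T A b c f hf0, Category.assoc,
            reassoc_of% (barLift_counit T (barMap T A b (c + 1) (tailHom f))),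
            reassoc_of% (barComult_counit T A c), ← h3, h4]
        · cases a with
          | zero => exact absurd (fun i : Fin 0 => i.elim0) hg
          | succ a =>
            have hg0 : g 0 = 0 := by
              by_contra h
              exact hg (ne_zero_of_head g h)
            have hfg : (f.comp g) 0 = 0 := by simp [hg0, hf0]
            have h3 := ih (a + (b + 1) + (c + 1)) (by omega) a (b + 1) (c + 1) (tailHom g) f rfl
            have h4 : tailHom (f.comp g) = f.comp (tailHom g) := rfl
            rw [barMap_head T A a c _ hfg, h4, h3, barMap_head T A b c f hf0,
              barMap_head T A a b g hg0, barLift_comp, barLift_comp]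
            simp only [Category.assoc]
            rw [reassoc_of% (barLift_comult T (barMap T A b (c + 1) (tailHom f))),
              reassoc_of% (barComult_coassoc T A c)]

/-- `T^n` applied to a morphism. -/
def barObjMap {A A' : D} (w : A ⟶ A') : ∀ n, barObj T A n ⟶ barObj T A' n
  | 0 => w
  | n + 1 => barLift T (barObjMap w n)

lemma barObjMap_id (A : D) (n : ℕ) : barObjMap T (𝟙 A) n = 𝟙 _ := by
  induction n with
  | zero => rfl
  | succ n ih => rw [barObjMap, ih, barLift_id]

lemma barObjMap_comp {A A' A'' : D} (w : A ⟶ A') (w' : A' ⟶ A'') (n : ℕ) :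
    barObjMap T (w ≫ w') n = barObjMap T w n ≫ barObjMap T w' n := by
  induction n with
  | zero => rfl
  | succ n ih => rw [barObjMap, ih, barLift_comp]; rfl

lemma barMap_naturality {A A' : D} (w : A ⟶ A') (a b : ℕ) (f : Fin a →o Fin b) :
    barMap T A a b f ≫ barObjMap T w a = barObjMap T w b ≫ barMap T A' a b f := by
  induction hN : a + b using Nat.strong_induction_on generalizing a b with
  | _ N ih =>
  subst hN
  cases b with
  | zero =>
    cases a with
    | succ a => exact (f 0).elim0
    | zero => rw [barMap, barMap, Category.id_comp, Category.comp_id]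
  | succ b =>
    by_cases hf : ∀ i, f i ≠ 0
    · rw [barMap_skip T A a b f hf, barMap_skip T A' a b f hf, Category.assoc,
        ih (a + b) (by omega) a b _ rfl, barObjMap, reassoc_of% (barLift_counit T)]
    · cases a with
      | zero => exact absurd (fun i : Fin 0 => i.elim0) hf
      | succ a =>
        have hf0 : f 0 = 0 := by
          by_contra h
          exact hf (ne_zero_of_head f h)
        rw [barMap_head T A a b f hf0, barMap_head T A' a b f hf0, Category.assoc]
        change _ ≫ _ ≫ barLift T (barObjMap T w a) = barLift T (barObjMap T w b) ≫ _
        rw [← barLift_comp, ih (a + (b + 1)) (by omega) a (b + 1) _ rfl, barLift_comp,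
          reassoc_of% (barLift_comult T)]
        rfl

/-- The bar construction `[n] ↦ T^{n+1} A` of a comonad. -/
def bar : D ⥤ SimplicialObject D where
  obj A :=
    { obj n := barObj T A (n.unop.len + 1)
      map f := barMap T A _ _ f.unop.toOrderHom
      map_id n := barMap_id T A _
      map_comp f g := barMap_comp T A _ _ _ g.unop.toOrderHom f.unop.toOrderHom }
  map w :=
    { app n := barObjMap T w _
      naturality _ _ f := barMap_naturality T w _ _ f.unop.toOrderHom }
  map_id A := by ext n; exact barObjMap_id T A _
  map_comp w w' := by ext n; exact barObjMap_comp T w w' _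
end Bar

section Resolution

/-- `(k → A) ↦ (k → k[A])`, where `k[A]` is the free commutative `k`-algebra on the underlying
set of `A`. -/
noncomputable def freeObj (f : Arrow CommRingCat.{u}) : Arrow CommRingCat.{u} :=
  Arrow.mk (CommRingCat.ofHom (MvPolynomial.C : f.left →+* MvPolynomial f.right f.left))

noncomputable def freeMapHom {f g : Arrow CommRingCat.{u}} (w : f ⟶ g) :
    MvPolynomial f.right f.left →+* MvPolynomial g.right g.left :=
  MvPolynomial.eval₂Hom (MvPolynomial.C.comp w.left.hom) (fun a => MvPolynomial.X (w.right.hom a))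

noncomputable def freeMap {f g : Arrow CommRingCat.{u}} (w : f ⟶ g) : freeObj f ⟶ freeObj g :=
  Arrow.homMk w.left (CommRingCat.ofHom (freeMapHom w)) (by
    ext x
    exact (MvPolynomial.eval₂Hom_C _ _ x).symm)

noncomputable def freeCounitHom (f : Arrow CommRingCat.{u}) :
    MvPolynomial f.right f.left →+* f.right :=
  MvPolynomial.eval₂Hom f.hom.hom id

/-- The evaluation `k[A] → A`, `[a] ↦ a`. -/
noncomputable def freeCounit (f : Arrow CommRingCat.{u}) : freeObj f ⟶ f :=
  Arrow.homMk (𝟙 _) (CommRingCat.ofHom (freeCounitHom f)) (by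
    ext x
    exact (MvPolynomial.eval₂Hom_C _ _ x).symm)

noncomputable def freeComultHom (f : Arrow CommRingCat.{u}) :
    MvPolynomial f.right f.left →+* MvPolynomial (MvPolynomial f.right f.left) f.left :=
  MvPolynomial.eval₂Hom MvPolynomial.C (fun a => MvPolynomial.X (MvPolynomial.X a))

/-- The map `k[A] → k[k[A]]`, `[a] ↦ [[a]]`. -/
noncomputable def freeComult (f : Arrow CommRingCat.{u}) : freeObj f ⟶ freeObj (freeObj f) :=
  Arrow.homMk (𝟙 _) (CommRingCat.ofHom (freeComultHom f)) (by
    ext x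
    exact (MvPolynomial.eval₂Hom_C _ _ x).symm)

/-- The variable `[a]` of `k[A]`. -/
noncomputable def freeVar {f : Arrow CommRingCat.{u}} (a : f.right) : (freeObj f).right :=
  (MvPolynomial.X a : MvPolynomial f.right f.left)

lemma freeMap_var {f g : Arrow CommRingCat.{u}} (w : f ⟶ g) (a : f.right) :
    (freeMap w).right.hom (freeVar a) = freeVar (w.right.hom a) :=
  MvPolynomial.eval₂Hom_X' _ _ a

lemma freeCounit_var (f : Arrow CommRingCat.{u}) (a : f.right) :
    (freeCounit f).right.hom (freeVar a) = a :=
  MvPolynomial.eval₂Hom_X' _ _ a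

lemma freeComult_var (f : Arrow CommRingCat.{u}) (a : f.right) :
    (freeComult f).right.hom (freeVar a) = freeVar (freeVar a) :=
  MvPolynomial.eval₂Hom_X' _ _ a

lemma comp_right_apply {f g h : Arrow CommRingCat.{u}} (v : f ⟶ g) (w : g ⟶ h) (a : f.right) :
    (v ≫ w).right.hom a = w.right.hom (v.right.hom a) := rfl

lemma id_right_apply (f : Arrow CommRingCat.{u}) (a : f.right) :
    CommRingCat.Hom.hom (CommaMorphism.right (𝟙 f)) a = a := rfl

lemma freeHom_ext {f g : Arrow CommRingCat.{u}} {a b : freeObj f ⟶ g} (h₁ : a.left = b.left)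
    (h₂ : ∀ x : f.right, a.right.hom (freeVar x) = b.right.hom (freeVar x)) : a = b := by
  refine CommaMorphism.ext h₁ ?_
  ext1
  refine MvPolynomial.ringHom_ext ?_ h₂
  intro r
  have ha := congrArg (fun z => z.hom r) a.w
  have hb := congrArg (fun z => z.hom r) b.w
  have hab : g.hom.hom (a.left.hom r) = g.hom.hom (b.left.hom r) := by rw [h₁]
  exact (ha.symm.trans hab).trans hb

lemma freeMap_id (f : Arrow CommRingCat.{u}) : freeMap (𝟙 f) = 𝟙 (freeObj f) :=
  freeHom_ext rfl (fun x => by rw [freeMap_var]; rfl)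

lemma freeMap_comp {f g h : Arrow CommRingCat.{u}} (v : f ⟶ g) (w : g ⟶ h) :
    freeMap (v ≫ w) = freeMap v ≫ freeMap w :=
  freeHom_ext rfl (fun x => by
    rw [freeMap_var, comp_right_apply, comp_right_apply, freeMap_var, freeMap_var])

lemma freeCounit_naturality {f g : Arrow CommRingCat.{u}} (w : f ⟶ g) :
    freeMap w ≫ freeCounit g = freeCounit f ≫ w :=
  freeHom_ext ((Category.comp_id _).trans (Category.id_comp _).symm) (fun x => by
    rw [comp_right_apply, comp_right_apply, freeMap_var, freeCounit_var, freeCounit_var])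

lemma freeComult_naturality {f g : Arrow CommRingCat.{u}} (w : f ⟶ g) :
    freeMap w ≫ freeComult g = freeComult f ≫ freeMap (freeMap w) :=
  freeHom_ext ((Category.comp_id _).trans (Category.id_comp _).symm) (fun x => by
    rw [comp_right_apply, comp_right_apply, freeMap_var, freeComult_var, freeComult_var,
      freeMap_var, freeMap_var])

lemma freeComult_coassoc (f : Arrow CommRingCat.{u}) :
    freeComult f ≫ freeMap (freeComult f) = freeComult f ≫ freeComult (freeObj f) :=
  freeHom_ext (f := f) (g := freeObj (freeObj (freeObj f)))
    (show 𝟙 f.left ≫ 𝟙 f.left = 𝟙 f.left ≫ 𝟙 f.left from rfl) (fun x => by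
    have h₁ := comp_right_apply (freeComult f) (freeMap (freeComult f)) (freeVar x)
    have h₂ := comp_right_apply (freeComult f) (freeComult (freeObj f)) (freeVar x)
    have h₃ := freeMap_var (freeComult f) (freeVar x)
    have h₄ := freeComult_var (freeObj f) (freeVar x)
    rw [freeComult_var] at h₁ h₂ h₃
    exact h₁.trans (h₃.trans (h₄.symm.trans h₂.symm)))

lemma freeComult_counit (f : Arrow CommRingCat.{u}) :
    freeComult f ≫ freeCounit (freeObj f) = 𝟙 (freeObj f) :=
  freeHom_ext (Category.comp_id _) (fun x => by
    rw [comp_right_apply, freeComult_var, freeCounit_var, id_right_apply])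

lemma freeComult_map_counit (f : Arrow CommRingCat.{u}) :
    freeComult f ≫ freeMap (freeCounit f) = 𝟙 (freeObj f) :=
  freeHom_ext (Category.comp_id _) (fun x => by
    rw [comp_right_apply, freeComult_var, freeMap_var, freeCounit_var, id_right_apply])

noncomputable def freeFunctor : Arrow CommRingCat.{u} ⥤ Arrow CommRingCat.{u} where
  obj := freeObj
  map := freeMap
  map_id := freeMap_id
  map_comp := freeMap_comp

/-- The comonad of free commutative algebras. -/
noncomputable def freeComonad : Comonad (Arrow CommRingCat.{u}) where
  toFunctor := freeFunctor
  ε := { app := freeCounit, naturality := fun _ _ w => freeCounit_naturality w }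
  δ := { app := freeComult, naturality := fun _ _ w => freeComult_naturality w }
  coassoc := freeComult_coassoc
  left_counit := freeComult_counit
  right_counit := freeComult_map_counit

variable {k R : SimplicialObject CommRingCat.{u}} (φ : k ⟶ R)

/-- The structure maps `k_n → S_n` of a simplicial commutative `R`-algebra `S`. -/
def structureArrow (S : Under R) : SimplicialObject (Arrow CommRingCat.{u}) where
  obj n := Arrow.mk ((φ ≫ S.hom).app n)
  map f := Arrow.homMk (k.map f) (S.right.map f) ((φ ≫ S.hom).naturality f)
  map_id n := CommaMorphism.ext (k.map_id n) (S.right.map_id n)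
  map_comp f g := CommaMorphism.ext (k.map_comp f g) (S.right.map_comp f g)

def structureArrowMap {S S' : Under R} (w : S ⟶ S') :
    structureArrow φ S ⟶ structureArrow φ S' where
  app n := Arrow.homMk (𝟙 _) (w.right.app n) (by
    have h := congrArg (fun z => (φ ≫ z).app n) (Under.w w)
    exact (Category.id_comp _).trans h.symm)
  naturality _ _ f := CommaMorphism.ext ((Category.comp_id _).trans (Category.id_comp _).symm)
    (w.right.naturality f)

/-- A functorial resolution of simplicial commutative `R`-algebras `S` by simplicial commutative
`k`-algebras that are polynomial in each degree: the diagonal of the bisimplicial object that is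
obtained by applying the bar construction of the comonad of free algebras to each `k_n → S_n`.
In degree `n` it is `k_n[k_n[ ⋯ k_n[S_n] ⋯ ]]`, with `n + 1` iterations. -/
noncomputable def resolution : Under R ⥤ SimplicialObject (Arrow CommRingCat.{u}) where
  obj S :=
    { obj n := ((bar freeComonad).obj ((structureArrow φ S).obj n)).obj n
      map {m n} f := ((bar freeComonad).map ((structureArrow φ S).map f)).app m ≫
        ((bar freeComonad).obj ((structureArrow φ S).obj n)).map f
      map_id n := by
        simp only [CategoryTheory.Functor.map_id, NatTrans.id_app, Category.comp_id]
      map_comp {m n p} f g := by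
        simp only [Functor.map_comp, NatTrans.comp_app, Category.assoc]
        rw [NatTrans.naturality_assoc] }
  map {S S'} w :=
    { app n := ((bar freeComonad).map ((structureArrowMap φ w).app n)).app n
      naturality m n f := by
        dsimp only
        rw [Category.assoc, NatTrans.naturality, ← Category.assoc, ← Category.assoc,
          ← NatTrans.comp_app, ← NatTrans.comp_app, ← Functor.map_comp, ← Functor.map_comp,
          NatTrans.naturality] }
  map_id S := by
    refine NatTrans.ext (funext fun n => ?_)
    exact congrArg (fun z => z.app n) ((bar freeComonad).map_id ((structureArrow φ S).obj n))
  map_comp {S S' S''} w w' := by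
    refine NatTrans.ext (funext fun n => ?_)
    have h : (structureArrowMap φ (w ≫ w')).app n =
        (structureArrowMap φ w).app n ≫ (structureArrowMap φ w').app n :=
      CommaMorphism.ext (Category.comp_id _).symm rfl
    change ((bar freeComonad).map ((structureArrowMap φ (w ≫ w')).app n)).app n = _
    rw [h, Functor.map_comp]
    rfl

end Resolution

section Loday

/-- `A ⊗_k ⋯ ⊗_k A` (`n` factors) for `f : k → A`, as the coproduct of `n` copies of `A` in
commutative `k`-algebras, that is, the pushout of `n` copies of `f` in commutative rings. -/
noncomputable def tensorObj (n : ℕ) (f : Arrow CommRingCat.{u}) : CommRingCat.{u} :=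
  widePushout f.left (fun _ : Fin n => f.right) (fun _ => f.hom)

/-- The structure map `k → A ⊗_k ⋯ ⊗_k A`. -/
noncomputable def tensorHead (n : ℕ) (f : Arrow CommRingCat.{u}) : f.left ⟶ tensorObj n f :=
  WidePushout.head (fun _ : Fin n => f.hom)

/-- The inclusion `a ↦ 1 ⊗ ⋯ ⊗ a ⊗ ⋯ ⊗ 1` of the factor with index `j`. -/
noncomputable def tensorInj {n : ℕ} (f : Arrow CommRingCat.{u}) (j : Fin n) :
    f.right ⟶ tensorObj n f :=
  WidePushout.ι (fun _ : Fin n => f.hom) j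

lemma hom_tensorInj {n : ℕ} (f : Arrow CommRingCat.{u}) (j : Fin n) :
    f.hom ≫ tensorInj f j = tensorHead n f :=
  WidePushout.arrow_ι (fun _ : Fin n => f.hom) j

noncomputable def tensorDesc {n : ℕ} {f : Arrow CommRingCat.{u}} {A : CommRingCat.{u}}
    (h : f.left ⟶ A) (g : Fin n → (f.right ⟶ A)) (w : ∀ j, f.hom ≫ g j = h) :
    tensorObj n f ⟶ A :=
  WidePushout.desc h g w

lemma tensorHead_desc {n : ℕ} {f : Arrow CommRingCat.{u}} {A : CommRingCat.{u}}
    (h : f.left ⟶ A) (g : Fin n → (f.right ⟶ A)) (w : ∀ j, f.hom ≫ g j = h) :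
    tensorHead n f ≫ tensorDesc h g w = h :=
  WidePushout.head_desc _ _ _ _

lemma tensorInj_desc {n : ℕ} {f : Arrow CommRingCat.{u}} {A : CommRingCat.{u}}
    (h : f.left ⟶ A) (g : Fin n → (f.right ⟶ A)) (w : ∀ j, f.hom ≫ g j = h) (j : Fin n) :
    tensorInj f j ≫ tensorDesc h g w = g j :=
  WidePushout.ι_desc _ _ _ _ _

lemma tensor_hom_ext {n : ℕ} {f : Arrow CommRingCat.{u}} {A : CommRingCat.{u}}
    {p q : tensorObj n f ⟶ A} (h₁ : tensorHead n f ≫ p = tensorHead n f ≫ q)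
    (h₂ : ∀ j, tensorInj f j ≫ p = tensorInj f j ≫ q) : p = q :=
  WidePushout.hom_ext _ _ _ h₂ h₁

/-- The map `A^{⊗ n} → A'^{⊗ n}` induced by a map from `k → A` to `k' → A'`. -/
noncomputable def tensorArrowMap (n : ℕ) {f g : Arrow CommRingCat.{u}} (w : f ⟶ g) :
    tensorObj n f ⟶ tensorObj n g :=
  tensorDesc (w.left ≫ tensorHead n g) (fun j => w.right ≫ tensorInj g j) (fun j => by
    have h : f.hom ≫ w.right = w.left ≫ g.hom := w.w.symm
    rw [← Category.assoc, h, Category.assoc, hom_tensorInj])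

/-- The map `A^{⊗ m} → A^{⊗ n}` induced by `θ : {0, …, m - 1} → {0, …, n - 1}`: the factor
with index `j` of the target is the product of the entries with index in `θ⁻¹(j)`
(`1` if there are none). -/
noncomputable def tensorIndexMap {m n : ℕ} (θ : Fin m → Fin n) (f : Arrow CommRingCat.{u}) :
    tensorObj m f ⟶ tensorObj n f :=
  tensorDesc (tensorHead n f) (fun j => tensorInj f (θ j)) (fun j => hom_tensorInj f (θ j))

/-- The `n`-fold tensor power as a functor of `k → A`. -/
noncomputable def tensorPow (n : ℕ) : Arrow CommRingCat.{u} ⥤ CommRingCat.{u} where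
  obj := tensorObj n
  map := tensorArrowMap n
  map_id f := tensor_hom_ext
    (by rw [tensorArrowMap, tensorHead_desc, Category.comp_id]; exact Category.id_comp _)
    (fun j => by rw [tensorArrowMap, tensorInj_desc, Category.comp_id]; exact Category.id_comp _)
  map_comp {f g h} v w := by
    have e₁ : (v ≫ w).left = v.left ≫ w.left := rfl
    have e₂ : (v ≫ w).right = v.right ≫ w.right := rfl
    refine tensor_hom_ext ?_ (fun j => ?_)
    · simp only [tensorArrowMap]
      rw [tensorHead_desc, ← Category.assoc (tensorHead n f), tensorHead_desc, Category.assoc,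
        tensorHead_desc, e₁, Category.assoc]
    · simp only [tensorArrowMap]
      rw [tensorInj_desc, ← Category.assoc (tensorInj f j), tensorInj_desc, Category.assoc,
        tensorInj_desc, e₂, Category.assoc]

noncomputable def tensorPowMap {m n : ℕ} (θ : Fin m → Fin n) :
    tensorPow.{u} m ⟶ tensorPow.{u} n where
  app := tensorIndexMap θ
  naturality f g w := by
    change tensorArrowMap m w ≫ tensorIndexMap θ g = tensorIndexMap θ f ≫ tensorArrowMap n w
    refine tensor_hom_ext ?_ (fun j => ?_)
    · simp only [tensorArrowMap, tensorIndexMap]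
      rw [← Category.assoc, tensorHead_desc, ← Category.assoc, tensorHead_desc, tensorHead_desc,
        Category.assoc, tensorHead_desc]
    · simp only [tensorArrowMap, tensorIndexMap]
      rw [← Category.assoc, tensorInj_desc, ← Category.assoc, tensorInj_desc, tensorInj_desc,
        Category.assoc, tensorInj_desc]

lemma tensorPowMap_id (n : ℕ) : tensorPowMap.{u} (fun j : Fin n => j) = 𝟙 _ := by
  ext f : 2
  change tensorIndexMap _ f = 𝟙 (tensorObj n f)
  refine tensor_hom_ext ?_ (fun j => ?_)
  · rw [tensorIndexMap, tensorHead_desc, Category.comp_id]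
  · rw [tensorIndexMap, tensorInj_desc, Category.comp_id]

lemma tensorPowMap_comp {m n p : ℕ} (θ : Fin m → Fin n) (η : Fin n → Fin p) :
    tensorPowMap.{u} θ ≫ tensorPowMap η = tensorPowMap (fun j => η (θ j)) := by
  ext f : 2
  change tensorIndexMap θ f ≫ tensorIndexMap η f = tensorIndexMap _ f
  simp only [tensorIndexMap]
  refine tensor_hom_ext ?_ (fun j => ?_)
  · rw [← Category.assoc, tensorHead_desc, tensorHead_desc, tensorHead_desc]
  · rw [← Category.assoc, tensorInj_desc, tensorInj_desc, tensorInj_desc]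

/-- The underlying abelian group of a ring, in a universe that is large enough for the category
of all simplicial rings to be small. -/
noncomputable def toAb : CommRingCat.{u} ⥤ AddCommGrpCat.{u + 1} :=
  forget₂ CommRingCat RingCat ⋙ forget₂ RingCat AddCommGrpCat ⋙
    AddCommGrpCat.uliftFunctor.{u + 1, u}

end Loday

section Hochschild

/-- The functor `(k → A) ↦ A^{⊗ (n + 1)}`, the Hochschild chains of degree `n`. -/
noncomputable def hoch (n : ℕ) : Arrow CommRingCat.{u} ⥤ AddCommGrpCat.{u + 1} :=
  tensorPow (n + 1) ⋙ toAb

noncomputable def hochMap {m n : ℕ} (θ : Fin (m + 1) → Fin (n + 1)) : hoch.{u} m ⟶ hoch.{u} n :=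
  Functor.whiskerRight (tensorPowMap θ) toAb

lemma hochMap_id (n : ℕ) : hochMap.{u} (fun j : Fin (n + 1) => j) = 𝟙 _ := by
  rw [hochMap, tensorPowMap_id]
  exact Functor.whiskerRight_id _

lemma hochMap_comp {m n p : ℕ} (θ : Fin (m + 1) → Fin (n + 1)) (η : Fin (n + 1) → Fin (p + 1)) :
    hochMap.{u} θ ≫ hochMap η = hochMap (fun j => η (θ j)) := by
  have h : hochMap.{u} (fun j => η (θ j)) =
      Functor.whiskerRight (tensorPowMap θ ≫ tensorPowMap η) toAb := by
    rw [tensorPowMap_comp]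
    rfl
  rw [h, Functor.whiskerRight_comp]
  rfl

/-- The positions of `a_0, …, a_{n+1}` in
`d_i (a_0 ⊗ ⋯ ⊗ a_{n+1}) = a_0 ⊗ ⋯ ⊗ a_i a_{i+1} ⊗ ⋯ ⊗ a_{n+1}` (for `i ≤ n`) and
`d_{n+1} (a_0 ⊗ ⋯ ⊗ a_{n+1}) = a_{n+1} a_0 ⊗ a_1 ⊗ ⋯ ⊗ a_n`. -/
def faceIdx (n i : ℕ) (j : Fin (n + 1 + 1)) : Fin (n + 1) :=
  ⟨(if (j : ℕ) ≤ i then (j : ℕ) else j - 1) % (n + 1), Nat.mod_lt _ n.succ_pos⟩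

lemma faceIdx_last (n i : ℕ) (j : Fin (n + 1 + 1)) (h : (j : ℕ) = n + 1) :
    (faceIdx n i j : ℕ) = if n + 1 ≤ i then 0 else n := by
  simp only [faceIdx]
  split_ifs <;> first | omega | simp [h]

lemma faceIdx_le (n i : ℕ) (j : Fin (n + 1 + 1)) (h : (j : ℕ) < n + 1) (h' : (j : ℕ) ≤ i) :
    (faceIdx n i j : ℕ) = j := by
  simp only [faceIdx, if_pos h', Nat.mod_eq_of_lt h]

lemma faceIdx_gt (n i : ℕ) (j : Fin (n + 1 + 1)) (h' : i < (j : ℕ)) :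
    (faceIdx n i j : ℕ) = j - 1 := by
  have h := j.2
  simp only [faceIdx, if_neg (not_le.2 h')]
  exact Nat.mod_eq_of_lt (by omega)

/-- The positions of `a_0, …, a_n` in `a_n ⊗ a_0 ⊗ ⋯ ⊗ a_{n-1}`. -/
def rotIdx (n : ℕ) (j : Fin (n + 1)) : Fin (n + 1) :=
  ⟨(j + 1) % (n + 1), Nat.mod_lt _ n.succ_pos⟩

lemma rotIdx_last (n : ℕ) (j : Fin (n + 1)) (h : (j : ℕ) = n) : (rotIdx n j : ℕ) = 0 := by
  simp [rotIdx, h]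

lemma rotIdx_lt (n : ℕ) (j : Fin (n + 1)) (h : (j : ℕ) < n) : (rotIdx n j : ℕ) = j + 1 :=
  Nat.mod_eq_of_lt (by omega)

noncomputable def hochFace (n i : ℕ) : hoch.{u} (n + 1) ⟶ hoch.{u} n := hochMap (faceIdx n i)

/-- The Hochschild differential `b = ∑ (-1)^i d_i`. -/
noncomputable def hochB (n : ℕ) : hoch.{u} (n + 1) ⟶ hoch.{u} n :=
  ∑ i ∈ Finset.range (n + 2), (-1 : ℤ) ^ i • hochFace n i

/-- The signed cyclic operator `t (a_0 ⊗ ⋯ ⊗ a_n) = (-1)^n a_n ⊗ a_0 ⊗ ⋯ ⊗ a_{n-1}`. -/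
noncomputable def cycT (n : ℕ) : End (hoch.{u} n) := (-1 : ℤ) ^ n • hochMap (rotIdx n)

/-- The norm `N = 1 + t + ⋯ + t^n`. -/
noncomputable def cycN (n : ℕ) : End (hoch.{u} n) := ∑ i ∈ Finset.range (n + 1), cycT n ^ i

/-- The extra degeneracy `s (a_0 ⊗ ⋯ ⊗ a_n) = 1 ⊗ a_0 ⊗ ⋯ ⊗ a_n`. -/
noncomputable def hochS (n : ℕ) : hoch.{u} n ⟶ hoch.{u} (n + 1) := hochMap Fin.succ

/-- Connes' operator `B = (1 - t) s N`. -/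
noncomputable def connesB (n : ℕ) : hoch.{u} n ⟶ hoch.{u} (n + 1) :=
  cycN n ≫ hochS n ≫ (𝟙 _ - cycT (n + 1))

lemma hochFace_comp (n i j : ℕ) (hj : j ≤ i) (hi : i ≤ n + 1) :
    hochFace.{u} (n + 1) j ≫ hochFace n i = hochFace (n + 1) (i + 1) ≫ hochFace n j := by
  rw [hochFace, hochFace, hochFace, hochFace, hochMap_comp, hochMap_comp]
  congr 1
  funext l
  have hl := l.2
  apply Fin.ext
  rcases Nat.lt_or_ge i l with h₁ | h₁
  · have e₁ : (faceIdx (n + 1) j l : ℕ) = l - 1 := faceIdx_gt _ _ _ (by omega)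
    by_cases h₂ : (l : ℕ) = i + 1
    · rcases Nat.lt_or_ge (l : ℕ) (n + 2) with h₃ | h₃
      · have e₂ : (faceIdx (n + 1) (i + 1) l : ℕ) = l := faceIdx_le _ _ _ h₃ (by omega)
        rw [faceIdx_le n i _ (by omega) (by omega), faceIdx_gt n j _ (by omega), e₁, e₂]
      · have e₂ : (faceIdx (n + 1) (i + 1) l : ℕ) = 0 := by
          rw [faceIdx_last (n + 1) (i + 1) l (by omega), if_pos (by omega)]
        rw [faceIdx_last n i _ (by omega), faceIdx_le n j _ (by omega) (by omega), e₂,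
          if_pos (by omega)]
    · have e₂ : (faceIdx (n + 1) (i + 1) l : ℕ) = l - 1 := faceIdx_gt _ _ _ (by omega)
      rw [faceIdx_gt n i _ (by omega), faceIdx_gt n j _ (by omega), e₁, e₂]
  · have e₂ : (faceIdx (n + 1) (i + 1) l : ℕ) = l := faceIdx_le _ _ _ (by omega) (by omega)
    rcases Nat.lt_or_ge j l with h₂ | h₂
    · have e₁ : (faceIdx (n + 1) j l : ℕ) = l - 1 := faceIdx_gt _ _ _ h₂
      rw [faceIdx_le n i _ (by omega) (by omega), faceIdx_gt n j _ (by omega), e₁, e₂]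
    · have e₁ : (faceIdx (n + 1) j l : ℕ) = l := faceIdx_le _ _ _ (by omega) h₂
      rcases Nat.lt_or_ge (l : ℕ) (n + 1) with h₃ | h₃
      · rw [faceIdx_le n i _ (by omega) (by omega), faceIdx_le n j _ (by omega) (by omega), e₁, e₂]
      · rw [faceIdx_last n i _ (by omega), faceIdx_last n j _ (by omega), if_pos (by omega),
          if_pos (by omega)]

lemma hochB_comp (n : ℕ) : hochB.{u} (n + 1) ≫ hochB n = 0 := by
  rw [hochB, hochB, Finset.sum_range, Finset.sum_range]
  simp only [Preadditive.comp_sum, Preadditive.sum_comp, ← Finset.sum_product']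
  let P := Fin (n + 2) × Fin (n + 3)
  let S : Finset P := {ij : P | (ij.2 : ℕ) ≤ (ij.1 : ℕ)}
  change ∑ x ∈ (Finset.univ : Finset (Fin (n + 2))) ×ˢ (Finset.univ : Finset (Fin (n + 3))), _ = _
  rw [Finset.univ_product_univ, ← Finset.sum_add_sum_compl S, ← eq_neg_iff_add_eq_zero,
    ← Finset.sum_neg_distrib]
  let φ : ∀ ij : P, ij ∈ S → P := fun ij hij =>
    (Fin.castLT ij.2 (lt_of_le_of_lt (Finset.mem_filter.mp hij).right (Fin.is_lt ij.1)), ij.1.succ)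
  apply Finset.sum_bij φ
  · intro ij hij
    simp_rw [S, φ, Finset.compl_filter, Finset.mem_filter_univ, Fin.val_succ,
      Fin.val_castLT] at hij ⊢
    lia
  · rintro ⟨i, j⟩ hij ⟨i', j'⟩ hij' h
    rw [Prod.mk_inj]
    exact ⟨by simpa [φ] using! congr_arg Prod.snd h,
      by simpa [φ, Fin.castSucc_castLT] using! congr_arg Fin.castSucc (congr_arg Prod.fst h)⟩
  · rintro ⟨i', j'⟩ hij'
    simp_rw [S, Finset.compl_filter, Finset.mem_filter_univ, not_le] at hij'
    refine ⟨(j'.pred <| ?_, Fin.castSucc i'), ?_, ?_⟩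
    · rintro rfl
      simp only [Fin.val_zero, not_lt_zero] at hij'
    · simpa [S] using! Nat.le_sub_one_of_lt hij'
    · simp only [φ, Fin.castLT_castSucc, Fin.succ_pred]
  · rintro ⟨i, j⟩ hij
    dsimp only
    simp only [Preadditive.zsmul_comp, Preadditive.comp_zsmul, smul_smul, ← neg_smul]
    have hij' : (j : ℕ) ≤ i := by simpa [S] using! hij
    have hi := i.2
    congr 1
    · simp only [φ, Fin.val_succ, pow_add, pow_one, mul_neg, neg_neg, mul_one]
      apply mul_comm
    · rw [hochFace_comp n i j hij' (by omega)]
      rfl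

/-- The signed faces `(-1)^i d_i`. -/
noncomputable def sFace (n i : ℕ) : hoch.{u} (n + 1) ⟶ hoch.{u} n := (-1 : ℤ) ^ i • hochFace n i

lemma cycT_sFace_zero (n : ℕ) : cycT.{u} (n + 1) ≫ sFace n 0 = sFace n (n + 1) := by
  rw [cycT, sFace, sFace, hochFace, hochFace, Preadditive.zsmul_comp, Preadditive.comp_zsmul,
    hochMap_comp, pow_zero, one_smul]
  congr 2
  funext l
  have hl := l.2
  apply Fin.ext
  rcases Nat.lt_or_ge (l : ℕ) (n + 1) with h | h
  · have e := rotIdx_lt (n + 1) l h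
    rw [faceIdx_gt n 0 _ (by omega), faceIdx_le n (n + 1) _ h (by omega), e]
    omega
  · have e := rotIdx_last (n + 1) l (by omega)
    rw [faceIdx_le n 0 _ (by omega) (by omega), faceIdx_last n (n + 1) _ (by omega), e,
      if_pos le_rfl]

lemma cycT_sFace_succ (n i : ℕ) (hi : i ≤ n) :
    cycT.{u} (n + 1) ≫ sFace n (i + 1) = sFace n i ≫ cycT n := by
  rw [cycT, cycT, sFace, sFace, hochFace, hochFace, Preadditive.zsmul_comp,
    Preadditive.comp_zsmul, Preadditive.zsmul_comp, Preadditive.comp_zsmul,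
    hochMap_comp, hochMap_comp, smul_smul, smul_smul]
  congr 1
  · ring
  congr 1
  funext l
  have hl := l.2
  apply Fin.ext
  rcases Nat.lt_or_ge (l : ℕ) (n + 1) with h | h
  · have e := rotIdx_lt (n + 1) l h
    rcases Nat.lt_or_ge i l with h' | h'
    · have e' := faceIdx_gt n i l h'
      rw [faceIdx_gt n (i + 1) _ (by omega), rotIdx_lt n _ (by omega), e, e']
      omega
    · have e' := faceIdx_le n i l h h'
      rcases Nat.lt_or_ge (l : ℕ) n with h'' | h''
      · rw [faceIdx_le n (i + 1) _ (by omega) (by omega), rotIdx_lt n _ (by omega), e, e']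
      · rw [faceIdx_last n (i + 1) _ (by omega), rotIdx_last n _ (by omega), if_pos (by omega)]
  · have e := rotIdx_last (n + 1) l (by omega)
    have e' := faceIdx_gt n i l (by omega)
    rw [faceIdx_le n (i + 1) _ (by omega) (by omega), rotIdx_last n _ (by omega), e]

lemma hochMap_rot_pow (n m : ℕ) : cycT.{u} n ^ m =
    ((-1 : ℤ) ^ n) ^ m • hochMap (fun j : Fin (n + 1) =>
      ⟨(j + m) % (n + 1), Nat.mod_lt _ n.succ_pos⟩) := by
  induction m with
  | zero =>
    rw [pow_zero, pow_zero, one_smul]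
    have : (fun j : Fin (n + 1) => (⟨(j + 0) % (n + 1), Nat.mod_lt _ n.succ_pos⟩ : Fin (n + 1))) =
        fun j => j := by
      funext j
      apply Fin.ext
      simp [Nat.mod_eq_of_lt j.2]
    rw [this, hochMap_id]
    rfl
  | succ m ih =>
    rw [pow_succ, ih, End.mul_def, cycT, Preadditive.zsmul_comp, Preadditive.comp_zsmul,
      hochMap_comp, smul_smul, pow_succ, mul_comm]
    congr 2
    funext j
    apply Fin.ext
    simp only [rotIdx, Nat.mod_add_mod]
    congr 1
    ring

lemma cycT_pow (n : ℕ) : cycT.{u} n ^ (n + 1) = 1 := by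
  rw [hochMap_rot_pow, ← pow_mul, (Nat.even_mul_succ_self n).neg_one_pow, one_smul]
  have : (fun j : Fin (n + 1) =>
      (⟨(j + (n + 1)) % (n + 1), Nat.mod_lt _ n.succ_pos⟩ : Fin (n + 1))) = fun j => j := by
    funext j
    apply Fin.ext
    simp [Nat.mod_eq_of_lt j.2]
  rw [this, hochMap_id]
  rfl

lemma cycT_mul_cycN (n : ℕ) : cycT.{u} n * cycN n = cycN n := by
  have h : cycN.{u} n = ∑ i ∈ Finset.range (n + 1), cycT n ^ i := rfl
  have h' : cycT.{u} n * cycN n = ∑ i ∈ Finset.range (n + 1), cycT n ^ (i + 1) := by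
    rw [h, Finset.mul_sum]
    simp only [pow_succ']
  rw [h', h, Finset.sum_range_succ, Finset.sum_range_succ', cycT_pow, pow_zero]

lemma cycN_mul_cycT (n : ℕ) : cycN.{u} n * cycT n = cycN n := by
  have h : cycN.{u} n = ∑ i ∈ Finset.range (n + 1), cycT n ^ i := rfl
  have h' : cycN.{u} n * cycT n = ∑ i ∈ Finset.range (n + 1), cycT n ^ (i + 1) := by
    rw [h, Finset.sum_mul]
    simp only [pow_succ]
  rw [h', h, Finset.sum_range_succ, Finset.sum_range_succ', cycT_pow, pow_zero]

lemma cycN_comp_cycT (n : ℕ) : cycN.{u} n ≫ cycT n = cycN n := cycT_mul_cycN n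

lemma cycT_comp_cycN (n : ℕ) : cycT.{u} n ≫ cycN n = cycN n := cycN_mul_cycT n

lemma cycN_comp_pow (n i : ℕ) : cycN.{u} n ≫ (cycT n ^ i : End (hoch n)) = cycN n := by
  induction i with
  | zero => exact Category.comp_id _
  | succ i ih =>
    rw [pow_succ', End.mul_def, ← Category.assoc, ih, cycN_comp_cycT]

/-- The differential `b' = ∑_{i ≤ n} (-1)^i d_i`, without the last face. -/
noncomputable def hochB' (n : ℕ) : hoch.{u} (n + 1) ⟶ hoch.{u} n :=
  ∑ i ∈ Finset.range (n + 1), sFace n i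

lemma hochB_eq (n : ℕ) : hochB.{u} n = ∑ i ∈ Finset.range (n + 2), sFace n i := rfl

lemma one_sub_cycT_comp_hochB (n : ℕ) :
    (𝟙 _ - cycT.{u} (n + 1)) ≫ hochB n = hochB' n ≫ (𝟙 _ - cycT n) := by
  rw [Preadditive.sub_comp, Preadditive.comp_sub, Category.id_comp, Category.comp_id]
  have h : cycT.{u} (n + 1) ≫ hochB n = sFace n (n + 1) + hochB' n ≫ cycT n := by
    rw [hochB_eq, hochB', Finset.sum_range_succ', Preadditive.comp_add, Preadditive.comp_sum,
      Preadditive.sum_comp, cycT_sFace_zero, add_comm (sFace n (n + 1))]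
    congr 1
    refine Finset.sum_congr rfl (fun i hi => cycT_sFace_succ n i ?_)
    have := Finset.mem_range.1 hi
    omega
  rw [h, hochB_eq, Finset.sum_range_succ, ← hochB']
  abel

lemma pow_comp_sFace (n i : ℕ) (hi : i ≤ n + 1) :
    (cycT.{u} (n + 1) ^ i : End _) ≫ sFace n i = sFace n 0 ≫ (cycT n ^ i : End _) := by
  induction i with
  | zero => exact (Category.id_comp _).trans (Category.comp_id _).symm
  | succ i ih =>
    rw [pow_succ', pow_succ', End.mul_def, End.mul_def, Category.assoc,
      cycT_sFace_succ n i (by omega), ← Category.assoc, ih (by omega), Category.assoc]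

lemma cycN_comp_hochB' (n : ℕ) :
    cycN.{u} (n + 1) ≫ hochB' n = cycN (n + 1) ≫ sFace n 0 ≫ cycN n := by
  have h : cycN.{u} n = ∑ i ∈ Finset.range (n + 1), cycT n ^ i := rfl
  rw [hochB', Preadditive.comp_sum, h]
  erw [Preadditive.comp_sum, Preadditive.comp_sum]
  refine Finset.sum_congr rfl (fun i hi => ?_)
  have hi' := Finset.mem_range.1 hi
  rw [← pow_comp_sFace n i (by omega), ← Category.assoc, cycN_comp_pow]

lemma sFace_comp_cycN (n j : ℕ) (hj : j ≤ n + 1) :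
    sFace.{u} n (n + 1 - j) ≫ cycN n =
      (cycT (n + 1) ^ j : End _) ≫ cycT (n + 1) ≫ sFace n 0 ≫ cycN n := by
  induction j with
  | zero =>
    rw [← Category.assoc (cycT (n + 1)), cycT_sFace_zero]
    exact (Category.id_comp _).symm
  | succ j ih =>
    have e : n + 1 - j = n + 1 - (j + 1) + 1 := by omega
    rw [pow_succ, End.mul_def, Category.assoc, ← ih (by omega), e, ← Category.assoc,
      cycT_sFace_succ n _ (by omega), Category.assoc, cycT_comp_cycN]

lemma hochB_comp_cycN (n : ℕ) :
    hochB.{u} n ≫ cycN n = cycN (n + 1) ≫ sFace n 0 ≫ cycN n := by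
  have h : cycN.{u} (n + 1) = ∑ i ∈ Finset.range (n + 2), cycT (n + 1) ^ i := rfl
  have h' : cycN.{u} (n + 1) ≫ sFace n 0 ≫ cycN n =
      cycN (n + 1) ≫ cycT (n + 1) ≫ sFace n 0 ≫ cycN n := by
    rw [← Category.assoc (cycN (n + 1)) (cycT (n + 1)), cycN_comp_cycT]
  rw [h', hochB_eq, ← Finset.sum_range_reflect, Preadditive.sum_comp, h]
  erw [Preadditive.sum_comp]
  refine Finset.sum_congr rfl (fun i hi => ?_)
  have hi' := Finset.mem_range.1 hi
  exact sFace_comp_cycN n i (by omega)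

lemma hochS_comp_sFace_zero (n : ℕ) : hochS.{u} n ≫ sFace n 0 = 𝟙 _ := by
  rw [hochS, sFace, pow_zero, one_smul, hochFace, hochMap_comp]
  have : (fun j : Fin (n + 1) => faceIdx n 0 j.succ) = fun j => j := by
    funext j
    apply Fin.ext
    simp [faceIdx, Nat.mod_eq_of_lt j.2]
  rw [this, hochMap_id]

lemma hochS_comp_sFace_succ (n i : ℕ) (hi : i ≤ n) :
    hochS.{u} (n + 1) ≫ sFace (n + 1) (i + 1) = -(sFace n i ≫ hochS n) := by
  rw [hochS, hochS, sFace, sFace, hochFace, hochFace, Preadditive.comp_zsmul,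
    Preadditive.zsmul_comp, hochMap_comp, hochMap_comp, pow_succ, mul_neg, mul_one, neg_smul]
  congr 3
  funext j
  have hj := j.2
  apply Fin.ext
  simp only [faceIdx, Fin.val_succ]
  by_cases h : (j : ℕ) ≤ i
  · simp [h, Nat.mod_eq_of_lt (show (j : ℕ) < n + 1 by omega)]
    omega
  · simp [h, Nat.mod_eq_of_lt (show (j : ℕ) - 1 < n + 1 by omega)]
    rw [Nat.mod_eq_of_lt (by omega)]
    omega

lemma hochS_comp_hochB' (n : ℕ) :
    hochS.{u} (n + 1) ≫ hochB' (n + 1) = 𝟙 _ - hochB' n ≫ hochS n := by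
  rw [hochB', Finset.sum_range_succ', Preadditive.comp_add, hochS_comp_sFace_zero,
    Preadditive.comp_sum, hochB', Preadditive.sum_comp, sub_eq_add_neg, add_comm (𝟙 _),
    ← Finset.sum_neg_distrib]
  congr 1
  refine Finset.sum_congr rfl (fun i hi => hochS_comp_sFace_succ n i ?_)
  have := Finset.mem_range.1 hi
  omega

lemma one_sub_cycT_comp_cycN (n : ℕ) : (𝟙 _ - cycT.{u} n) ≫ cycN n = 0 := by
  rw [Preadditive.sub_comp, Category.id_comp, cycT_comp_cycN, sub_self]

lemma cycN_comp_one_sub_cycT (n : ℕ) : cycN.{u} n ≫ (𝟙 _ - cycT n) = 0 := by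
  rw [Preadditive.comp_sub, Category.comp_id, cycN_comp_cycT, sub_self]

lemma connesB_comp (n : ℕ) : connesB.{u} n ≫ connesB (n + 1) = 0 := by
  simp only [connesB, Category.assoc]
  rw [reassoc_of% (one_sub_cycT_comp_cycN (n + 1))]
  simp

lemma connesB_hochB_zero : connesB.{u} 0 ≫ hochB 0 = 0 := by
  have h : hochB'.{u} 0 = sFace 0 0 := by rw [hochB', Finset.sum_range_one]
  rw [connesB, Category.assoc, Category.assoc, one_sub_cycT_comp_hochB, h,
    ← Category.assoc (hochS 0), hochS_comp_sFace_zero, Category.id_comp, cycN_comp_one_sub_cycT]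

lemma hochB_connesB (n : ℕ) :
    hochB.{u} n ≫ connesB n + connesB (n + 1) ≫ hochB (n + 1) = 0 := by
  have h₁ : hochB.{u} n ≫ connesB n =
      cycN (n + 1) ≫ hochB' n ≫ hochS n ≫ (𝟙 _ - cycT (n + 1)) := by
    rw [connesB, ← Category.assoc, hochB_comp_cycN, ← cycN_comp_hochB', Category.assoc]
  have h₂ : connesB.{u} (n + 1) ≫ hochB (n + 1) =
      cycN (n + 1) ≫ (𝟙 _ - hochB' n ≫ hochS n) ≫ (𝟙 _ - cycT (n + 1)) := by
    rw [connesB, Category.assoc, Category.assoc, one_sub_cycT_comp_hochB,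
      ← Category.assoc (hochS (n + 1)), hochS_comp_hochB']
  rw [h₁, h₂, ← Preadditive.comp_add, ← Category.assoc (hochB' n), ← Preadditive.add_comp,
    add_sub_cancel, Category.id_comp, cycN_comp_one_sub_cycT]

end Hochschild

section CyclicComplexes

variable {k R : SimplicialObject CommRingCat.{u}} (φ : k ⟶ R)

/-- The chain complexes (in the direction of the resolution) of the derived Hochschild chains
`Q^{⊗ (i + 1)}`, where `Q` is the resolution of `S`. -/
noncomputable def derivedHoch (i : ℕ) : Under R ⥤ ChainComplex AddCommGrpCat.{u + 1} ℕ :=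
  resolution φ ⋙ (SimplicialObject.whiskering _ _).obj (hoch i) ⋙
    AlgebraicTopology.alternatingFaceMapComplex _

noncomputable def derivedHochMap {i i' : ℕ} (f : hoch.{u} i ⟶ hoch i') :
    derivedHoch φ i ⟶ derivedHoch φ i' :=
  Functor.whiskerLeft (resolution φ)
    (Functor.whiskerRight ((SimplicialObject.whiskering _ _).map f)
      (AlgebraicTopology.alternatingFaceMapComplex _))

/-- The group `(Q_j)^{⊗ (i + 1)}`, where `Q` is the resolution of `S`. -/
noncomputable abbrev Chains (S : Under R) (i j : ℕ) : AddCommGrpCat.{u + 1} :=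
  ((derivedHoch φ i).obj S).X j

noncomputable def chainsOp {i i' : ℕ} (f : hoch.{u} i ⟶ hoch i') (S : Under R) (j : ℕ) :
    Chains φ S i j →+ Chains φ S i' j :=
  (((derivedHochMap φ f).app S).f j).hom

/-- The alternating sum of the faces in the direction of the resolution. -/
noncomputable def chainsD (S : Under R) (i j : ℕ) : Chains φ S i (j + 1) →+ Chains φ S i j :=
  (((derivedHoch φ i).obj S).d (j + 1) j).hom

noncomputable def chainsMap {S S' : Under R} (w : S ⟶ S') (i j : ℕ) :
    Chains φ S i j →+ Chains φ S' i j :=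
  (((derivedHoch φ i).map w).f j).hom

variable {φ}

lemma chainsOp_comp {i i' i'' : ℕ} (f : hoch.{u} i ⟶ hoch i') (g : hoch i' ⟶ hoch i'')
    {S : Under R} {j : ℕ} (x : Chains φ S i j) :
    chainsOp φ g S j (chainsOp φ f S j x) = chainsOp φ (f ≫ g) S j x := rfl

lemma chainsOp_add {i i' : ℕ} (f g : hoch.{u} i ⟶ hoch i') {S : Under R} {j : ℕ}
    (x : Chains φ S i j) :
    chainsOp φ (f + g) S j x = chainsOp φ f S j x + chainsOp φ g S j x := rfl

lemma chainsOp_zero {i i' : ℕ} {S : Under R} {j : ℕ} (x : Chains φ S i j) :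
    chainsOp φ (0 : hoch.{u} i ⟶ hoch i') S j x = 0 := rfl

lemma chainsD_comp {S : Under R} {i j : ℕ} (x : Chains φ S i (j + 1 + 1)) :
    chainsD φ S i j (chainsD φ S i (j + 1) x) = 0 :=
  congrArg (fun f => f.hom x) (((derivedHoch φ i).obj S).d_comp_d (j + 1 + 1) (j + 1) j)

lemma chainsD_op {i i' : ℕ} (f : hoch.{u} i ⟶ hoch i') {S : Under R} {j : ℕ}
    (x : Chains φ S i (j + 1)) :
    chainsD φ S i' j (chainsOp φ f S (j + 1) x) = chainsOp φ f S j (chainsD φ S i j x) :=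
  congrArg (fun f => f.hom x) (((derivedHochMap φ f).app S).comm (j + 1) j)

lemma chainsMap_op {S S' : Under R} (w : S ⟶ S') {i i' : ℕ} (f : hoch.{u} i ⟶ hoch i') {j : ℕ}
    (x : Chains φ S i j) :
    chainsMap φ w i' j (chainsOp φ f S j x) = chainsOp φ f S' j (chainsMap φ w i j x) :=
  (congrArg (fun f => (f.f j).hom x) ((derivedHochMap φ f).naturality w)).symm

lemma chainsMap_D {S S' : Under R} (w : S ⟶ S') {i j : ℕ} (x : Chains φ S i (j + 1)) :
    chainsMap φ w i j (chainsD φ S i j x) = chainsD φ S' i j (chainsMap φ w i (j + 1) x) :=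
  (congrArg (fun f => f.hom x) (((derivedHoch φ i).map w).comm (j + 1) j)).symm

lemma chainsMap_id (S : Under R) {i j : ℕ} (x : Chains φ S i j) : chainsMap φ (𝟙 S) i j x = x :=
  congrArg (fun f => (f.f j).hom x) ((derivedHoch φ i).map_id S)

lemma chainsMap_comp {S S' S'' : Under R} (w : S ⟶ S') (w' : S' ⟶ S'') {i j : ℕ}
    (x : Chains φ S i j) :
    chainsMap φ (w ≫ w') i j x = chainsMap φ w' i j (chainsMap φ w i j x) :=
  congrArg (fun f => (f.f j).hom x) ((derivedHoch φ i).map_comp w w')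

variable (φ)

/-- The part of `B x` that lies in `Chains φ S i j`. -/
noncomputable def connesPart (S : Under R) (x : ∀ i j, Chains φ S i j) :
    ∀ i j, Chains φ S i j
  | 0, _ => 0
  | i + 1, j => chainsOp φ (connesB i) S j (x i j)

/-- The total differential `b ± d + B` on families of chains. -/
noncomputable def totalD (S : Under R) (x : ∀ i j, Chains φ S i j) (i j : ℕ) : Chains φ S i j :=
  chainsOp φ (hochB i) S j (x (i + 1) j) + (-1 : ℤ) ^ i • chainsD φ S i j (x i (j + 1)) +
    connesPart φ S x i j

/-- Let `M` be the total mixed complex of `S`, so that `M_q` is the sum of the groups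
`Chains φ S i j` with `i + j = q`. In cohomological degree `n`, the coefficient of `u ^ p`
(`u` having cohomological degree `2`) lies in `M_{2 p - n}`. The condition says that
`Chains φ S i j` contributes to the coefficient of `u ^ p` for some `p ∈ I`. -/
def InRange (I : Set ℤ) (n : ℤ) (i j : ℕ) : Prop := ∃ p ∈ I, (i : ℤ) + j + n = 2 * p

/-- The group `∏_{p ∈ I} M_{2 p - n} u ^ p`. -/
def cycGroup (I : Set ℤ) (n : ℤ) (S : Under R) : AddSubgroup (∀ i j, Chains φ S i j) where
  carrier := {x | ∀ i j, ¬ InRange I n i j → x i j = 0}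
  zero_mem' _ _ _ := rfl
  add_mem' {x y} hx hy i j h := by
    change x i j + y i j = 0
    rw [hx i j h, hy i j h, add_zero]
  neg_mem' {x} hx i j h := by
    change -x i j = 0
    rw [hx i j h, neg_zero]

lemma connesPart_add (S : Under R) (x y : ∀ i j, Chains φ S i j) (i j : ℕ) :
    connesPart φ S (x + y) i j = connesPart φ S x i j + connesPart φ S y i j := by
  cases i with
  | zero => exact (add_zero _).symm
  | succ i => exact map_add _ _ _

lemma totalD_add (S : Under R) (x y : ∀ i j, Chains φ S i j) (i j : ℕ) :
    totalD φ S (x + y) i j = totalD φ S x i j + totalD φ S y i j := by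
  simp only [totalD, connesPart_add, Pi.add_apply, map_add, smul_add]
  abel

open scoped Classical in
/-- The differential `b ± d + u B` of `∏_{p ∈ I} M u ^ p`, where the terms `u ^ p` with `p ∉ I`
are discarded. -/
noncomputable def cycD (I : Set ℤ) (n : ℤ) (S : Under R) :
    cycGroup φ I n S →+ cycGroup φ I (n + 1) S where
  toFun x := ⟨fun i j => if InRange I (n + 1) i j then totalD φ S x.1 i j else 0,
    fun i j h => if_neg h⟩
  map_zero' := by
    have h : ∀ i j, totalD φ S 0 i j = 0 := fun i j => by
      have h := totalD_add φ S 0 0 i j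
      rw [add_zero] at h
      exact left_eq_add.1 h
    apply Subtype.ext
    funext i j
    change (if _ then totalD φ S 0 i j else 0) = 0
    rw [h, ite_self]
  map_add' x y := by
    apply Subtype.ext
    funext i j
    change (if _ then totalD φ S (x.1 + y.1) i j else 0) = (if _ then _ else 0) + (if _ then _ else 0)
    rw [totalD_add]
    split_ifs
    · rfl
    · exact (add_zero _).symm

variable {φ}

lemma cycD_apply {I : Set ℤ} {n : ℤ} {S : Under R} (x : cycGroup φ I n S) {i j : ℕ}
    (h : InRange I (n + 1) i j) : (cycD φ I n S x).1 i j = totalD φ S x.1 i j := if_pos h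

lemma inRange_b {I : Set ℤ} {n : ℤ} {i j : ℕ} (h : InRange I (n + 1) i j) :
    InRange I n (i + 1) j := by
  obtain ⟨p, hp, h⟩ := h
  exact ⟨p, hp, by push_cast; linarith⟩

lemma inRange_d {I : Set ℤ} {n : ℤ} {i j : ℕ} (h : InRange I (n + 1) i j) :
    InRange I n i (j + 1) := by
  obtain ⟨p, hp, h⟩ := h
  exact ⟨p, hp, by push_cast; linarith⟩

lemma inRange_b' {I : Set ℤ} {n : ℤ} {i j : ℕ} (h : InRange I n (i + 1) j) :
    InRange I (n + 1) i j := by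
  obtain ⟨p, hp, h⟩ := h
  exact ⟨p, hp, by push_cast at h; linarith⟩

lemma inRange_d' {I : Set ℤ} {n : ℤ} {i j : ℕ} (h : InRange I n i (j + 1)) :
    InRange I (n + 1) i j := by
  obtain ⟨p, hp, h⟩ := h
  exact ⟨p, hp, by push_cast at h; linarith⟩

lemma cycD_comp (I : Set ℤ) (n : ℤ) (S : Under R) (x : cycGroup φ I n S) :
    cycD φ I (n + 1) S (cycD φ I n S x) = 0 := by
  set y := cycD φ I n S x with hy
  apply Subtype.ext
  funext i j
  by_cases h : InRange I (n + 1 + 1) i j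
  swap
  · exact if_neg h
  rw [cycD_apply y h]
  change totalD φ S y.1 i j = 0
  have hb : y.1 (i + 1) j = totalD φ S x.1 (i + 1) j := cycD_apply x (inRange_b h)
  have hd : y.1 i (j + 1) = totalD φ S x.1 i (j + 1) := cycD_apply x (inRange_d h)
  rw [totalD, hb, hd]
  have hdd := chainsD_comp (x.1 i (j + 1 + 1))
  have hbb : ∀ z : Chains φ S (i + 1 + 1) j,
      chainsOp φ (hochB i) S j (chainsOp φ (hochB (i + 1)) S j z) = 0 := fun z => by
    rw [chainsOp_comp, hochB_comp, chainsOp_zero]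
  cases i with
  | zero =>
    have hBb : ∀ z : Chains φ S 0 j,
        chainsOp φ (hochB 0) S j (chainsOp φ (connesB 0) S j z) = 0 := fun z => by
      rw [chainsOp_comp, connesB_hochB_zero, chainsOp_zero]
    simp only [totalD, connesPart, map_add, map_zsmul, hbb, hBb, chainsD_op, hdd, smul_zero]
    simp
  | succ i =>
    have hBb : ∀ z : Chains φ S (i + 1) j,
        chainsOp φ (hochB (i + 1)) S j (chainsOp φ (connesB (i + 1)) S j z) =
          -chainsOp φ (connesB i) S j (chainsOp φ (hochB i) S j z) := fun z => by
      have e := chainsOp_add (φ := φ) (hochB i ≫ connesB i) (connesB (i + 1) ≫ hochB (i + 1)) z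
      rw [hochB_connesB, chainsOp_zero] at e
      rw [chainsOp_comp, chainsOp_comp]
      exact (neg_eq_of_add_eq_zero_right e.symm).symm
    have hBB : chainsOp φ (connesB i) S j (connesPart φ S x.1 i j) = 0 := by
      cases i with
      | zero => exact map_zero _
      | succ i =>
        change chainsOp φ (connesB (i + 1)) S j (chainsOp φ (connesB i) S j _) = 0
        rw [chainsOp_comp, connesB_comp, chainsOp_zero]
    by_cases h' : InRange I (n + 1) i j
    · have hB : y.1 i j = totalD φ S x.1 i j := cycD_apply x h'
      have hc : ∀ y : ∀ i j, Chains φ S i j,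
          connesPart φ S y (i + 1) j = chainsOp φ (connesB i) S j (y i j) := fun _ => rfl
      have hc' : connesPart φ S x.1 (i + 1) (j + 1) =
          chainsOp φ (connesB i) S (j + 1) (x.1 i (j + 1)) := rfl
      have hc'' : connesPart φ S x.1 (i + 1 + 1) j =
          chainsOp φ (connesB (i + 1)) S j (x.1 (i + 1) j) := rfl
      rw [hc, hB]
      simp only [totalD, hc', hc'', map_add, map_zsmul, hbb, hBb, chainsD_op, hdd, hBB,
        smul_zero, smul_add, pow_succ]
      simp only [mul_neg, mul_one, neg_smul, neg_neg]
      abel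
    · have hB : y.1 i j = 0 := y.2 i j h'
      have h₁ : x.1 (i + 1) j = 0 := x.2 _ _ (fun h => h' (inRange_b' h))
      have h₂ : x.1 i (j + 1) = 0 := x.2 _ _ (fun h => h' (inRange_d' h))
      simp only [connesPart, hB]
      simp only [totalD, connesPart, map_add, map_zsmul, hbb, chainsD_op, hdd, h₁, h₂,
        smul_zero, smul_add, pow_succ, map_zero]
      simp

/-- The functoriality of `cycGroup`. -/
noncomputable def cycMap (I : Set ℤ) (n : ℤ) {S S' : Under R} (w : S ⟶ S') :
    cycGroup φ I n S →+ cycGroup φ I n S' where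
  toFun x := ⟨fun i j => chainsMap φ w i j (x.1 i j), fun i j h => by
    change chainsMap φ w i j (x.1 i j) = 0
    rw [x.2 i j h, map_zero]⟩
  map_zero' := Subtype.ext (funext fun i => funext fun j => map_zero _)
  map_add' x y := Subtype.ext (funext fun i => funext fun j => map_add _ _ _)

lemma cycMap_id (I : Set ℤ) (n : ℤ) (S : Under R) (x : cycGroup φ I n S) :
    cycMap I n (𝟙 S) x = x :=
  Subtype.ext (funext fun i => funext fun j => chainsMap_id S (x.1 i j))

lemma cycMap_comp (I : Set ℤ) (n : ℤ) {S S' S'' : Under R} (w : S ⟶ S') (w' : S' ⟶ S'')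
    (x : cycGroup φ I n S) : cycMap I n (w ≫ w') x = cycMap I n w' (cycMap I n w x) :=
  Subtype.ext (funext fun i => funext fun j => chainsMap_comp w w' (x.1 i j))

lemma cycMap_D (I : Set ℤ) (n : ℤ) {S S' : Under R} (w : S ⟶ S') (x : cycGroup φ I n S) :
    cycMap I (n + 1) w (cycD φ I n S x) = cycD φ I n S' (cycMap I n w x) := by
  apply Subtype.ext
  funext i j
  by_cases h : InRange I (n + 1) i j
  · rw [cycD_apply _ h]
    change chainsMap φ w i j ((cycD φ I n S x).1 i j) = _
    rw [cycD_apply _ h, totalD, totalD, map_add, map_add, map_zsmul, chainsMap_op, chainsMap_D]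
    congr 1
    cases i with
    | zero => exact map_zero _
    | succ i => exact chainsMap_op w (connesB i) _
  · exact ((cycMap I (n + 1) w (cycD φ I n S x)).2 i j h).trans
      ((cycD φ I n S' (cycMap I n w x)).2 i j h).symm

variable (φ)

/-- The abelian category of functors from simplicial commutative `R`-algebras to abelian groups.
The groups live in a universe in which the category of simplicial `R`-algebras is small. -/
abbrev AbPsh (R : SimplicialObject CommRingCat.{u}) : Type (u + 2) :=
  Under R ⥤ AddCommGrpCat.{u + 1}

noncomputable def cycObj (I : Set ℤ) (n : ℤ) : AbPsh R where
  obj S := AddCommGrpCat.of (cycGroup φ I n S)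
  map w := AddCommGrpCat.ofHom (cycMap I n w)
  map_id S := AddCommGrpCat.hom_ext (AddMonoidHom.ext fun x => cycMap_id I n S x)
  map_comp w w' := AddCommGrpCat.hom_ext (AddMonoidHom.ext fun x => cycMap_comp I n w w' x)

noncomputable def cycDiff (I : Set ℤ) (n : ℤ) : cycObj φ I n ⟶ cycObj φ I (n + 1) where
  app S := AddCommGrpCat.ofHom (cycD φ I n S)
  naturality S S' w := by
    ext x
    exact (cycMap_D I n w x).symm

lemma cycDiff_comp (I : Set ℤ) (n : ℤ) : cycDiff φ I n ≫ cycDiff φ I (n + 1) = 0 := by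
  ext S x
  exact cycD_comp I n S x

/-- The cochain complex `∏_{p ∈ I} M u ^ p` with differential `b ± d + u B`, as a functor of the
simplicial commutative `R`-algebra. -/
noncomputable def cycComplex (I : Set ℤ) : CochainComplex (AbPsh R) ℤ :=
  CochainComplex.of (cycObj φ I) (cycDiff φ I) (cycDiff_comp φ I)

lemma cycComplex_d (I : Set ℤ) (n : ℤ) : (cycComplex φ I).d n (n + 1) = cycDiff φ I n :=
  CochainComplex.of_d (cycObj φ I) (cycDiff φ I) n

lemma InRange.mono {I J : Set ℤ} (h : I ⊆ J) {n : ℤ} {i j : ℕ} :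
    InRange I n i j → InRange J n i j := fun ⟨p, hp, e⟩ => ⟨p, h hp, e⟩

/-- The inclusion `∏_{p ≥ 0} M u ^ p → ∏_{p ∈ ℤ} M u ^ p`. -/
noncomputable def canMap (n : ℤ) (S : Under R) : cycGroup φ (Set.Ici 0) n S →+ cycGroup φ Set.univ n S :=
  AddSubgroup.inclusion (fun _ hx i j h => hx i j (fun h' => h (h'.mono (Set.subset_univ _))))

lemma canMap_D (n : ℤ) (S : Under R) (x : cycGroup φ (Set.Ici 0) n S) :
    cycD φ Set.univ n S (canMap φ n S x) = canMap φ (n + 1) S (cycD φ (Set.Ici 0) n S x) := by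
  apply Subtype.ext
  funext i j
  change (cycD φ Set.univ n S (canMap φ n S x)).1 i j = (cycD φ (Set.Ici 0) n S x).1 i j
  by_cases h : InRange (Set.Ici 0) (n + 1) i j
  · rw [cycD_apply _ h, cycD_apply _ (h.mono (Set.subset_univ _))]
    rfl
  · have h₀ : totalD φ S x.1 i j = 0 := by
      have h₁ : x.1 (i + 1) j = 0 := x.2 _ _ (fun h' => h (inRange_b' h'))
      have h₂ : x.1 i (j + 1) = 0 := x.2 _ _ (fun h' => h (inRange_d' h'))
      have h₃ : connesPart φ S x.1 i j = 0 := by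
        cases i with
        | zero => rfl
        | succ i =>
          have h₄ : x.1 i j = 0 := x.2 _ _ (fun ⟨p, hp, e⟩ => h
            ⟨p + 1, Set.mem_Ici.2 (by have := Set.mem_Ici.1 hp; omega), by push_cast; linarith⟩)
          change chainsOp φ (connesB i) S j (x.1 i j) = 0
          rw [h₄, map_zero]
      rw [totalD, h₁, h₂, h₃, map_zero, map_zero, smul_zero, add_zero, add_zero]
    refine Eq.trans ?_ ((cycD φ (Set.Ici 0) n S x).2 i j h).symm
    by_cases h' : InRange Set.univ (n + 1) i j
    · rw [cycD_apply _ h']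
      exact h₀
    · exact (cycD φ Set.univ n S _).2 i j h'

noncomputable def canHom (n : ℤ) : cycObj φ (Set.Ici 0) n ⟶ cycObj φ Set.univ n where
  app S := AddCommGrpCat.ofHom (canMap φ n S)
  naturality S S' w := by
    ext x
    rfl

lemma canHom_comm (n : ℤ) :
    canHom φ n ≫ cycDiff φ Set.univ n = cycDiff φ (Set.Ici 0) n ≫ canHom φ (n + 1) := by
  ext S x
  exact canMap_D φ n S x

noncomputable def canComplex : cycComplex φ (Set.Ici 0) ⟶ cycComplex φ Set.univ :=
  CochainComplex.ofHom (canHom φ) (fun n => by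
    rw [cycComplex_d, cycComplex_d]
    exact canHom_comm φ n)

end CyclicComplexes

section Localization

noncomputable instance (R : SimplicialObject CommRingCat.{u}) :
    HasDerivedCategory.{u + 2} (AbPsh R) := HasDerivedCategory.standard _

/-- The derived category of the abelian category `AbPsh R`. Its objects are functors (up to
objectwise quasi-isomorphism) from simplicial commutative `R`-algebras to complexes of abelian
groups. -/
abbrev DPsh (R : SimplicialObject CommRingCat.{u}) : Type (u + 2) := DerivedCategory (AbPsh R)

/-- The functor `A ↦ A[t]`. -/
noncomputable def polyRing : CommRingCat.{u} ⥤ CommRingCat.{u} where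
  obj A := CommRingCat.of (Polynomial A)
  map f := CommRingCat.ofHom (Polynomial.mapRingHom f.hom)
  map_id A := by
    ext1
    exact Polynomial.mapRingHom_id
  map_comp f g := by
    ext1
    exact (Polynomial.mapRingHom_comp _ _).symm

/-- The inclusion `A → A[t]`. -/
noncomputable def polyRingC : 𝟭 CommRingCat.{u} ⟶ polyRing where
  app A := CommRingCat.ofHom Polynomial.C
  naturality A A' f := by
    ext x
    exact (Polynomial.map_C _).symm

variable {R : SimplicialObject CommRingCat.{u}}

/-- The canonical map `S → S[t]` of simplicial commutative rings, which is `S_n → S_n[t]` in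
degree `n`. -/
noncomputable def polyC (S : SimplicialObject CommRingCat.{u}) :
    S ⟶ ((SimplicialObject.whiskering _ _).obj polyRing).obj S :=
  Functor.whiskerLeft S polyRingC

/-- The simplicial commutative `R`-algebra `S[t]`. -/
noncomputable def poly (S : Under R) : Under R := Under.mk (S.hom ≫ polyC S.right)

/-- The canonical map `S → S[t]` of simplicial commutative `R`-algebras. -/
noncomputable def polyIncl (S : Under R) : S ⟶ poly S := Under.homMk (polyC S.right) rfl

/-- A weak equivalence of simplicial commutative algebras: a map that is an isomorphism on all
`π_n`, that is, on the homology of the chain complexes of the underlying simplicial abelian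
groups. -/
def IsWeakEquiv {S S' : Under R} (w : S ⟶ S') : Prop :=
  QuasiIso ((AlgebraicTopology.alternatingFaceMapComplex AddCommGrpCat.{u}).map
    (((SimplicialObject.whiskering _ _).obj
      (forget₂ CommRingCat RingCat ⋙ forget₂ RingCat AddCommGrpCat)).map w.right))

variable (R)

/-- The functors that send weak equivalences to quasi-isomorphisms, that is, the functors on
the `∞`-category of animated `R`-algebras. -/
def IsHomotopical : ObjectProperty (DPsh R) := fun G =>
  ∀ (n : ℤ) ⦃S S' : Under R⦄ (w : S ⟶ S'), IsWeakEquiv w →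
    IsIso (((DerivedCategory.homologyFunctor (AbPsh R) n).obj G).map w)

/-- The presheaves `G` on the opposite of the `∞`-category of animated `R`-algebras, with values
in the derived category of abelian groups, that are `𝔸¹`-invariant: `G(S) → G(S[t])` is an
equivalence for all `S`. -/
def IsA1Invariant : ObjectProperty (DPsh R) := fun G =>
  IsHomotopical R G ∧ ∀ (n : ℤ) (S : Under R),
    IsIso (((DerivedCategory.homologyFunctor (AbPsh R) n).obj G).map (polyIncl S))

variable {R}

/-- `f : X ⟶ Y` is an `L_{𝔸¹}`-equivalence: `Hom(Y, G) → Hom(X, G)` is bijective for all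
`𝔸¹`-invariant `G`. -/
def IsA1Equivalence {X Y : DPsh R} (f : X ⟶ Y) : Prop := (IsA1Invariant R).isLocal f

/-- `η : X ⟶ L` exhibits `L` as the `𝔸¹`-localization of `X`, the reflection of `X` onto the
`𝔸¹`-invariant presheaves. -/
structure IsA1Localization {X L : DPsh R} (η : X ⟶ L) : Prop where
  invariant : IsA1Invariant R L
  equivalence : IsA1Equivalence η

variable {k : SimplicialObject CommRingCat.{u}} (φ : k ⟶ R)

/-- Derived Hochschild homology over `k`: the total complex of the Hochschild complex of the
resolution (only the power `u ^ 0` occurs, so that the differential is `b ± d`). -/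
noncomputable def HH : DPsh R := DerivedCategory.Q.obj (cycComplex φ {0})

/-- Cyclic homology `HC`, the homotopy orbits of `HH`: the complex `⨁_{p ≤ 0} M u ^ p` with
differential `b ± d + u B` (the sum is finite in each degree). -/
noncomputable def HC : DPsh R := DerivedCategory.Q.obj (cycComplex φ (Set.Iic 0))

/-- Negative cyclic homology `HC⁻`, the homotopy fixed points of `HH`: the complex
`∏_{p ≥ 0} M u ^ p` with differential `b ± d + u B`. -/
noncomputable def HCminus : DPsh R := DerivedCategory.Q.obj (cycComplex φ (Set.Ici 0))

/-- Periodic cyclic homology `HP`, the Tate construction of `HH`: the complex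
`∏_{p ∈ ℤ} M u ^ p` with differential `b ± d + u B`. -/
noncomputable def HP : DPsh R := DerivedCategory.Q.obj (cycComplex φ Set.univ)

/-- The canonical map `HC⁻ → HP`. -/
noncomputable def can : HCminus φ ⟶ HP φ := DerivedCategory.Q.map (canComplex φ)

end Localization

end A1

/-! Multiplication by `t` on the zeroth tensor factor, applied after `HH(S) → HH(S[t])`, is a path
of endomorphisms of `HH` that is the identity at `t = 1` and zero at `t = 0`. A functor `G` that
inverts `S → S[t]` cannot distinguish the two evaluations `S[t] → S`, since both are retractions of
the same equivalence. Hence every map `HH → G` equals its own composite with zero.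
`Inverts.eq_zero_of_path` is this argument in the derived category, where a map is a fraction and
precomposition with `S ↦ S[t]` is exact; `hom_singleton_eq_zero` is the outcome.

On the chain level the path has to be built on the resolution `Q`. There `t` lifts to the fully
nested variable `[⋯[t]⋯]`, which is compatible with all simplicial operators, but its values at `1`
and `0` are `[⋯[1]⋯]` and `[⋯[0]⋯]` instead of `1` and `0`. The difference of the two ends is
therefore multiplication by `[⋯[1]⋯] - [⋯[0]⋯]`, and what remains is a homotopy from this element to
`1`. For an integer `c`, the elements with `w` outer brackets around `c`, for `0 ≤ w ≤ n + 1`,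
behave under the simplicial operators like the `n`-simplices of `Δ¹` (`barMap_bracketed`). They form
an edge of `Q` between `c` and `[⋯[c]⋯]`; subtracting the edge for `0` from the edge for `1` gives
`bracketHomotopy`. These multiplications commute with `b`, because every face keeps position `0` in
place (`hochMul_hochB`). This is all that is needed when a single power of `u` is present, since
then the term `uB` is discarded; `cycPathHomotopy` assembles the result on the total complex.

For `HC` one removes powers of `u` one at a time from the top. The subcomplex `M u^p` of `∏_{q ≤ p}
M u^q` is a shift of `HH`, so a map to `G` factors through the quotient `∏_{q ≤ p - 1} M u^q`, and
so on. In a fixed degree these quotients are eventually zero, so their telescope vanishes and with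
it the map (`eq_zero_of_telescope`, `hom_Iic_eq_zero`). The telescope requires coproducts in the
derived category, which are computed degreewise because coproducts of abelian groups are exact.

Finally, `HC⁻ → HP` is a degreewise split injection whose cokernel is `∏_{p ≤ -1} M u^p`, a shift of
`HC`. This cone has no maps to `G` or to `G⟦1⟧`, so `can` induces a bijection on maps to `G`
(`bijective_mor₁_comp`). -/

namespace A1

/-! ### Paths and the vanishing of maps in the derived category of functors -/

section PathObject

open DerivedCategory

universe w₁ w₂ w₃ w₄ w₅

variable {C : Type w₁} [Category.{w₂} C] {A : Type w₃} [Category.{w₄} A] [Abelian A]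

/-- Precomposition of a complex of functors with an endofunctor. -/
noncomputable abbrev precomp (P : C ⥤ C) :
    CochainComplex (C ⥤ A) ℤ ⥤ CochainComplex (C ⥤ A) ℤ :=
  ((Functor.whiskeringLeft C C A).obj P).mapHomologicalComplex _

/-- The map `K ∘ P → K` induced by a natural transformation `P → 𝟭`. -/
def precompCounit {P : C ⥤ C} (e : P ⟶ 𝟭 C) (K : CochainComplex (C ⥤ A) ℤ) :
    (precomp P).obj K ⟶ K where
  f n := { app S := (K.X n).map (e.app S)
           naturality _ _ w := ((K.X n).map_comp _ _).symm.trans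
             ((congrArg (K.X n).map (e.naturality w)).trans ((K.X n).map_comp _ _)) }
  comm' i j _ := NatTrans.ext (funext fun S => (K.d i j).naturality (e.app S))

/-- The natural transformation from the identity to precomposition with `P`. -/
def precompUnitApp {P : C ⥤ C} (ι : 𝟭 C ⟶ P) :
    𝟭 (C ⥤ A) ⟶ (Functor.whiskeringLeft C C A).obj P where
  app F := { app S := F.map (ι.app S)
             naturality S S' w := by
               dsimp
               rw [← Functor.map_comp, ← Functor.map_comp, ← ι.naturality]
               rfl }
  naturality F F' f := by
    ext S
    exact (f.naturality (ι.app S)).symm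

/-- The map `K → K ∘ P` induced by a natural transformation `𝟭 → P`. -/
def precompUnit {P : C ⥤ C} (ι : 𝟭 C ⟶ P) (K : CochainComplex (C ⥤ A) ℤ) :
    K ⟶ (precomp P).obj K where
  f n := (precompUnitApp ι).app (K.X n)
  comm' i j _ := NatTrans.ext (funext fun S => (K.d i j).naturality (ι.app S))

lemma precompCounit_naturality {P : C ⥤ C} (e : P ⟶ 𝟭 C) {K L : CochainComplex (C ⥤ A) ℤ}
    (f : K ⟶ L) : precompCounit e K ≫ f = (precomp P).map f ≫ precompCounit e L := by
  ext n S
  exact (f.f n).naturality (e.app S)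

lemma precompUnit_counit {P : C ⥤ C} (ι : 𝟭 C ⟶ P) (e : P ⟶ 𝟭 C) (h : ι ≫ e = 𝟙 _)
    (K : CochainComplex (C ⥤ A) ℤ) : precompUnit ι K ≫ precompCounit e K = 𝟙 K := by
  ext n S
  have h' := congrArg (fun z => (K.X n).map (z.app S)) h
  exact ((K.X n).map_comp _ _).symm.trans (h'.trans ((K.X n).map_id S))

/-- Precomposition with `P` is exact, so the map induced on the `n`-th homology is the value of the
functor `K.homology n` on `ι`. -/
lemma quasiIso_precompUnit {P : C ⥤ C} (ι : 𝟭 C ⟶ P) (K : CochainComplex (C ⥤ A) ℤ)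
    (h : ∀ n S, IsIso ((K.homology n).map (ι.app S))) : QuasiIso (precompUnit ι K) := by
  refine ⟨fun n => ?_⟩
  rw [quasiIsoAt_iff_isIso_homologyMap]
  have e := ShortComplex.homologyMap_mapNatTrans (K.sc n) (precompUnitApp (A := A) ι)
  have : IsIso ((precompUnitApp (A := A) ι).app (K.sc n).homology) := by
    have : ∀ S, IsIso (((precompUnitApp (A := A) ι).app (K.sc n).homology).app S) := h n
    exact NatIso.isIso_of_isIso_app _
  have h' : IsIso (ShortComplex.homologyMap
      ((K.sc n).mapNatTrans (precompUnitApp (A := A) ι))) := by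
    rw [e]
    infer_instance
  exact h'

variable [HasDerivedCategory.{w₅} (C ⥤ A)]

/-- The cohomology functors of `G` invert a natural transformation. -/
def Inverts {P : C ⥤ C} (ι : 𝟭 C ⟶ P) (G : DerivedCategory (C ⥤ A)) : Prop :=
  ∀ (n : ℤ) (S : C), IsIso (((homologyFunctor (C ⥤ A) n).obj G).map (ι.app S))

lemma Inverts.of_iso {P : C ⥤ C} {ι : 𝟭 C ⟶ P} {G G' : DerivedCategory (C ⥤ A)} (e : G ≅ G')
    (h : Inverts ι G) : Inverts ι G' := fun n S =>
  (NatIso.isIso_map_iff ((homologyFunctor (C ⥤ A) n).mapIso e) (ι.app S)).1 (h n S)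

/-- Needed because surjectivity in `bijective_mor₁_comp` involves maps into `G⟦1⟧`; its cohomology
is that of `G`, reindexed. -/
lemma Inverts.shift {P : C ⥤ C} {ι : 𝟭 C ⟶ P} {G : DerivedCategory (C ⥤ A)}
    (h : Inverts ι G) : Inverts ι (G⟦(1 : ℤ)⟧) := fun n S =>
  (NatIso.isIso_map_iff (((homologyFunctor (C ⥤ A) 0).shiftIso 1 n (n + 1) (by lia)).app G)
    (ι.app S)).2 (h (n + 1) S)

lemma Inverts.quasiIso {P : C ⥤ C} {ι : 𝟭 C ⟶ P} {K : CochainComplex (C ⥤ A) ℤ}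
    (h : Inverts ι (Q.obj K)) : QuasiIso (precompUnit ι K) :=
  quasiIso_precompUnit ι K (fun n S =>
    (NatIso.isIso_map_iff ((homologyFunctorFactors (C ⥤ A) n).app K) (ι.app S)).1 (h n S))

/-- If the difference of the two ends of a path `X → X ∘ P` is homotopic to the identity, then
`X` has no maps to objects whose cohomology inverts `𝟭 → P`. -/
theorem Inverts.eq_zero_of_path {P : C ⥤ C} {ι : 𝟭 C ⟶ P} {e₀ e₁ : P ⟶ 𝟭 C} (h₀ : ι ≫ e₀ = 𝟙 _)
    (h₁ : ι ≫ e₁ = 𝟙 _) {X : CochainComplex (C ⥤ A) ℤ} (h : X ⟶ (precomp P).obj X)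
    (H : Homotopy (h ≫ precompCounit e₁ X - h ≫ precompCounit e₀ X) (𝟙 X))
    {G : DerivedCategory (C ⥤ A)} (hG : Inverts ι G) (f : Q.obj X ⟶ G) : f = 0 := by
  wlog hK : ∃ K, G = Q.obj K generalizing G
  · have := this (hG.of_iso (Q.objObjPreimageIso G).symm) (f ≫ (Q.objObjPreimageIso G).inv)
      ⟨_, rfl⟩
    rwa [Preadditive.IsIso.comp_right_eq_zero] at this
  obtain ⟨K, rfl⟩ := hK
  -- A map of complexes of functors is natural for precomposition, while `f` lives only in the
  -- derived category. So `f` is written as a fraction and naturality is used for `s` and `g`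
  -- separately.
  obtain ⟨X', s, hs, g, rfl⟩ := right_fac f
  have hs' : QuasiIso s := (isIso_Q_map_iff_quasiIso _ s).1 hs
  have hι := hG.quasiIso
  -- Both evaluations are left inverse to the unit of `K`, which is invertible in the derived
  -- category.
  have hev : Q.map (precompCounit e₀ K) = Q.map (precompCounit e₁ K) := by
    rw [← cancel_epi (Q.map (precompUnit ι K)), ← Q.map_comp, ← Q.map_comp,
      precompUnit_counit ι e₀ h₀, precompUnit_counit ι e₁ h₁]
  -- The evaluation is moved past the fraction, from `X` to `K`, where it no longer depends on the
  -- end `e₀` or `e₁`.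
  have key : ∀ e : P ⟶ 𝟭 C, Q.map (precompCounit e X) ≫ inv (Q.map s) ≫ Q.map g =
      inv (Q.map ((precomp P).map s)) ≫ Q.map ((precomp P).map g) ≫
        Q.map (precompCounit e K) := fun e => by
    rw [IsIso.eq_inv_comp, ← Q.map_comp_assoc, ← precompCounit_naturality e s, Q.map_comp_assoc,
      IsIso.hom_inv_id_assoc, ← Q.map_comp, precompCounit_naturality e g, Q.map_comp]
  have hid := Q_map_eq_of_homotopy _ H
  rw [Q.map_id, Q.map_sub, Q.map_comp, Q.map_comp] at hid
  rw [← Category.id_comp (inv (Q.map s) ≫ Q.map g), ← hid, Preadditive.sub_comp, Category.assoc,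
    Category.assoc, key, key, hev, sub_self]

end PathObject

/-! ### Coproducts in the derived category, from exact coproducts -/

section Coproduct

open DerivedCategory

universe w₁ w₂ w₃ w₄

variable {A : Type w₁} [Category.{w₂} A] [Abelian A] {α : Type w₃}

/-- A family of cochain complexes as a complex of families. -/
noncomputable def familyComplex (X : α → CochainComplex A ℤ) :
    CochainComplex (Discrete α ⥤ A) ℤ where
  X m := Discrete.functor fun n => (X n).X m
  d i j := Discrete.natTrans fun n => (X n.as).d i j
  shape i j h := by
    ext n
    simp [(X n.as).shape i j h]

noncomputable def familyMap {X Y : α → CochainComplex A ℤ} (f : ∀ n, X n ⟶ Y n) :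
    familyComplex X ⟶ familyComplex Y where
  f m := Discrete.natTrans fun n => (f n.as).f m
  comm' i j _ := by
    ext n
    simp [familyComplex]

/-- Homology in the category of families is computed componentwise, since evaluation at an index is
exact. -/
lemma quasiIso_familyMap {X Y : α → CochainComplex A ℤ} (f : ∀ n, X n ⟶ Y n)
    [∀ n, QuasiIso (f n)] : QuasiIso (familyMap f) := by
  refine ⟨fun m => ?_⟩
  rw [quasiIsoAt_iff_isIso_homologyMap]
  have : ∀ n : Discrete α, IsIso (((HomologicalComplex.homologyMap (familyMap f) m)).app n) := by
    intro n
    let E := (evaluation (Discrete α) A).obj n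
    have h₁ : QuasiIso ((E.mapHomologicalComplex _).map (familyMap f)) :=
      inferInstanceAs (QuasiIso (f n.as))
    have h₂ : IsIso (ShortComplex.homologyMap (E.mapShortComplex.map
        ((HomologicalComplex.shortComplexFunctor _ _ m).map (familyMap f)))) :=
      (quasiIsoAt_iff_isIso_homologyMap ((E.mapHomologicalComplex _).map (familyMap f)) m).1
        inferInstance
    have h₃ := ShortComplex.mapHomologyIso_hom_naturality
      ((HomologicalComplex.shortComplexFunctor _ _ m).map (familyMap f)) E
    have h₄ : IsIso (E.map (ShortComplex.homologyMap
        ((HomologicalComplex.shortComplexFunctor _ _ m).map (familyMap f)))) := by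
      rw [← Iso.inv_comp_eq] at h₃
      rw [← h₃]
      exact IsIso.comp_isIso' inferInstance (IsIso.comp_isIso' h₂ inferInstance)
    exact h₄
  exact NatIso.isIso_of_isIso_app _

variable [HasColimitsOfShape (Discrete α) A]

/-- The coproduct of a family of cochain complexes. -/
noncomputable def sumComplex (X : α → CochainComplex A ℤ) : CochainComplex A ℤ where
  X m := ∐ fun n => (X n).X m
  d i j := Limits.Sigma.map fun n => (X n).d i j
  shape i j h := by
    ext n
    simp [(X n).shape i j h]

/-- The map out of a coproduct in a fixed degree. -/
noncomputable def sumDescX {X : α → CochainComplex A ℤ} {m : ℤ} {Y : A}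
    (f : ∀ n, (X n).X m ⟶ Y) : (sumComplex X).X m ⟶ Y :=
  Limits.Sigma.desc f

noncomputable def sumι (X : α → CochainComplex A ℤ) (n : α) : X n ⟶ sumComplex X where
  f m := Limits.Sigma.ι (fun n => (X n).X m) n
  comm' i j _ := by simp [sumComplex]

lemma sumι_descX {X : α → CochainComplex A ℤ} {m : ℤ} {Y : A} (f : ∀ n, (X n).X m ⟶ Y) (n : α) :
    (sumι X n).f m ≫ sumDescX f = f n :=
  Limits.Sigma.ι_desc _ _

lemma sumι_descX_assoc {X : α → CochainComplex A ℤ} {m : ℤ} {Y Z : A}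
    (f : ∀ n, (X n).X m ⟶ Y) (n : α) (h : Y ⟶ Z) :
    (sumι X n).f m ≫ sumDescX f ≫ h = f n ≫ h := by
  rw [← Category.assoc, sumι_descX]

lemma sumComplex_X_hom_ext {X : α → CochainComplex A ℤ} {m : ℤ} {Y : A}
    {f g : (sumComplex X).X m ⟶ Y} (h : ∀ n, (sumι X n).f m ≫ f = (sumι X n).f m ≫ g) : f = g :=
  Limits.Sigma.hom_ext _ _ h

noncomputable def sumDesc {X : α → CochainComplex A ℤ} {Y : CochainComplex A ℤ}
    (f : ∀ n, X n ⟶ Y) : sumComplex X ⟶ Y where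
  f m := sumDescX fun n => (f n).f m
  comm' i j _ := sumComplex_X_hom_ext fun n => by
    rw [sumι_descX_assoc, HomologicalComplex.Hom.comm, HomologicalComplex.Hom.comm_assoc,
      sumι_descX]

lemma sumι_desc {X : α → CochainComplex A ℤ} {Y : CochainComplex A ℤ}
    (f : ∀ n, X n ⟶ Y) (n : α) : sumι X n ≫ sumDesc f = f n := by
  ext m
  exact sumι_descX _ n

lemma sumComplex_hom_ext {X : α → CochainComplex A ℤ} {Y : CochainComplex A ℤ}
    {f g : sumComplex X ⟶ Y} (h : ∀ n, sumι X n ≫ f = sumι X n ≫ g) : f = g := by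
  ext m : 1
  exact sumComplex_X_hom_ext (fun n => congrArg (fun z => z.f m) (h n))

noncomputable def sumMap {X Y : α → CochainComplex A ℤ} (f : ∀ n, X n ⟶ Y n) :
    sumComplex X ⟶ sumComplex Y :=
  sumDesc fun n => f n ≫ sumι Y n

/-- The coproduct is the exact functor `colim` applied to the complex of families, and exact
functors preserve quasi-isomorphisms. -/
lemma quasiIso_sumMap [HasExactColimitsOfShape (Discrete α) A] {X Y : α → CochainComplex A ℤ}
    (f : ∀ n, X n ⟶ Y n) [∀ n, QuasiIso (f n)] : QuasiIso (sumMap f) := by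
  have := quasiIso_familyMap f
  have h : QuasiIso (((colim (J := Discrete α) (C := A)).mapHomologicalComplex _).map
      (familyMap f)) := inferInstance
  have h' : ((colim (J := Discrete α) (C := A)).mapHomologicalComplex _).map (familyMap f) =
      sumMap f := by
    refine sumComplex_hom_ext (X := X) fun n => Eq.trans ?_ (sumι_desc _ n).symm
    ext m
    exact ι_colimMap _ _
  rwa [h'] at h

variable [HasDerivedCategory.{w₄} A] [HasExactColimitsOfShape (Discrete α) A]

/-- The homotopies of a family, on the coproduct. -/
noncomputable def sumHomotopy {X : α → CochainComplex A ℤ} {Y : CochainComplex A ℤ}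
    {f g : sumComplex X ⟶ Y} (H : ∀ n, Homotopy (sumι X n ≫ f) (sumι X n ≫ g)) :
    Homotopy f g where
  hom i j := sumDescX fun n => (H n).hom i j
  zero i j h := sumComplex_X_hom_ext fun n => by
    rw [sumι_descX, (H n).zero i j h, comp_zero]
  comm i := by
    refine sumComplex_X_hom_ext fun n => ?_
    have := (H n).comm i
    rw [dNext_eq _ (show (ComplexShape.up ℤ).Rel i (i + 1) from rfl),
      prevD_eq _ (show (ComplexShape.up ℤ).Rel (i - 1) i by simp)] at this ⊢
    rw [Preadditive.comp_add, Preadditive.comp_add, HomologicalComplex.Hom.comm_assoc,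
      sumι_descX, sumι_descX_assoc]
    exact this

/-- The existence half of the universal property of the coproduct in the derived category. Each
component is a right fraction, and the coproduct of the denominators is again a quasi-isomorphism.
-/
lemma exists_sum_desc {X : α → CochainComplex A ℤ} {G : DerivedCategory A}
    (f : ∀ n, Q.obj (X n) ⟶ G) :
    ∃ F : Q.obj (sumComplex X) ⟶ G, ∀ n, Q.map (sumι X n) ≫ F = f n := by
  wlog hK : ∃ K, G = Q.obj K generalizing G
  · obtain ⟨F, hF⟩ := this (fun n => f n ≫ (Q.objObjPreimageIso G).inv) ⟨_, rfl⟩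
    refine ⟨F ≫ (Q.objObjPreimageIso G).hom, fun n => ?_⟩
    rw [← Category.assoc, hF, Category.assoc, Iso.inv_hom_id, Category.comp_id]
  obtain ⟨K, rfl⟩ := hK
  choose X' s hs g hf using fun n => right_fac (f n)
  have hs' : ∀ n, QuasiIso (s n) := fun n => (isIso_Q_map_iff_quasiIso _ (s n)).1 (hs n)
  have := quasiIso_sumMap s
  refine ⟨inv (Q.map (sumMap s)) ≫ Q.map (sumDesc g), fun n => ?_⟩
  rw [hf n, IsIso.eq_inv_comp, ← Q.map_comp_assoc, ← sumι_desc (fun n => s n ≫ sumι X n) n,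
    ← sumMap, Q.map_comp_assoc, IsIso.hom_inv_id_assoc, ← Q.map_comp, sumι_desc]

/-- The derived category is a localization of the homotopy category with a calculus of right
fractions: maps that become equal are already equalized by a quasi-isomorphism into the source. -/
lemma exists_homotopy_of_Q_map_eq {X Y : CochainComplex A ℤ} {f g : X ⟶ Y}
    (h : Q.map f = Q.map g) : ∃ (X' : CochainComplex A ℤ) (s : X' ⟶ X), QuasiIso s ∧
      Nonempty (Homotopy (s ≫ f) (s ≫ g)) := by
  have h' : Qh.map ((HomotopyCategory.quotient A (ComplexShape.up ℤ)).map f) =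
      Qh.map ((HomotopyCategory.quotient A (ComplexShape.up ℤ)).map g) := by
    have e₁ := (quotientCompQhIso A).hom.naturality f
    have e₂ := (quotientCompQhIso A).hom.naturality g
    rw [h, ← e₂, cancel_mono] at e₁
    exact e₁
  obtain ⟨X', s, hs, e⟩ := (MorphismProperty.map_eq_iff_precomp Qh
    (HomotopyCategory.quasiIso A (ComplexShape.up ℤ)) _ _).1 h'
  obtain ⟨X', rfl⟩ := HomotopyCategory.quotient_obj_surjective X'
  obtain ⟨s, rfl⟩ := (HomotopyCategory.quotient _ _).map_surjective s
  rw [← Functor.map_comp, ← Functor.map_comp] at e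
  exact ⟨X', s, (HomotopyCategory.quotient_map_mem_quasiIso_iff s).1 hs,
    ⟨HomotopyCategory.homotopyOfEq _ _ e⟩⟩

/-- The uniqueness half of the universal property. The difference is a left fraction, so its
numerator is a genuine map out of the coproduct; the null-homotopies of the components, each after a
quasi-isomorphism, add up to one on the coproduct. -/
lemma sum_Q_hom_ext {X : α → CochainComplex A ℤ} {G : DerivedCategory A}
    {F F' : Q.obj (sumComplex X) ⟶ G} (h : ∀ n, Q.map (sumι X n) ≫ F = Q.map (sumι X n) ≫ F') :
    F = F' := by
  rw [← sub_eq_zero]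
  replace h : ∀ n, Q.map (sumι X n) ≫ (F - F') = 0 := fun n => by
    rw [Preadditive.comp_sub, h n, sub_self]
  generalize F - F' = φ at h
  wlog hK : ∃ K, G = Q.obj K generalizing G
  · have := this (F := 0) (F' := 0) (φ ≫ (Q.objObjPreimageIso G).inv)
      (fun n => by rw [← Category.assoc, h, zero_comp]) ⟨_, rfl⟩
    rwa [Preadditive.IsIso.comp_right_eq_zero] at this
  obtain ⟨K, rfl⟩ := hK
  obtain ⟨K', g, t, ht, rfl⟩ := left_fac φ
  have h' : ∀ n, Q.map (sumι X n ≫ g) = Q.map 0 := fun n => by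
    have := h n
    rw [← Category.assoc, Preadditive.IsIso.comp_right_eq_zero, ← Q.map_comp] at this
    rw [this, Q.map_zero]
  choose X' s hs H using fun n => exists_homotopy_of_Q_map_eq (h' n)
  have := quasiIso_sumMap s
  have H' : Homotopy (sumMap s ≫ g) 0 := sumHomotopy fun n =>
    (Homotopy.ofEq (by rw [sumMap, ← Category.assoc, sumι_desc, Category.assoc])).trans
      ((H n).some.trans (Homotopy.ofEq (by simp)))
  have e := Q_map_eq_of_homotopy _ H'
  rw [Q.map_comp, Q.map_zero, Preadditive.IsIso.comp_left_eq_zero] at e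
  rw [e, zero_comp]

end Coproduct

/-! ### Telescopes of sequences that vanish eventually in each degree -/

section Telescope

open DerivedCategory

universe w₁ w₂ w₃

variable {A : Type w₁} [Category.{w₂} A] [Abelian A] [HasColimitsOfShape (Discrete ℕ) A]
  {X : ℕ → CochainComplex A ℤ} (S : ∀ n, X n ⟶ X (n + 1))

/-- The shift of the coproduct of a sequence of complexes. -/
noncomputable def sumShift : sumComplex X ⟶ sumComplex X := sumDesc fun n => S n ≫ sumι X (n + 1)

/-- The partial sums of `(1 - sumShift)⁻¹`. -/
noncomputable def sumShiftPartial : ∀ (_ n : ℕ), X n ⟶ sumComplex X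
  | 0, _ => 0
  | k + 1, n => sumι X n + S n ≫ sumShiftPartial k (n + 1)

variable {S}

/-- The geometric series is defined by splitting off the first transition map; here the shift is
split off at the other end. The two recursions give the two sides of the inverse of `1 - sumShift`.
-/
lemma sumShiftPartial_succ' (k n : ℕ) : sumShiftPartial S (k + 1) n =
    sumι X n + sumShiftPartial S k n ≫ sumShift S := by
  induction k generalizing n with
  | zero => simp [sumShiftPartial]
  | succ k ih =>
    rw [sumShiftPartial, ih (n + 1), sumShiftPartial, Preadditive.add_comp,
      Preadditive.comp_add, sumShift, sumι_desc, Category.assoc]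

/-- In each degree the shift is nilpotent, so the geometric series is finite and inverts `1 -
sumShift`. -/
lemma isIso_one_sub_sumShift (h : ∀ m : ℤ, ∃ N, ∀ n, N ≤ n → IsZero ((X n).X m)) :
    IsIso (𝟙 _ - sumShift S) := by
  have : ∀ m, IsIso ((𝟙 _ - sumShift S).f m) := by
    intro m
    obtain ⟨N, hN⟩ := h m
    -- The additional term factors through `X (n + k)`, which is zero in degree `m`.
    have stab : ∀ k n, N ≤ n + k →
        (sumShiftPartial S (k + 1) n).f m = (sumShiftPartial S k n).f m := by
      intro k
      induction k with
      | zero => exact fun n hn => (hN n hn).eq_of_src _ _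
      | succ k ih =>
        intro n hn
        have e₁ : ∀ k, (sumShiftPartial S (k + 1) n).f m =
            (sumι X n).f m + (S n).f m ≫ (sumShiftPartial S k (n + 1)).f m := fun _ => rfl
        rw [e₁, e₁, ih (n + 1) (by omega)]
    -- `N` terms suffice for every `n` at once, because `N ≤ n + N`.
    let U : (sumComplex X).X m ⟶ (sumComplex X).X m :=
      sumDescX fun n => (sumShiftPartial S N n).f m
    have hU : ∀ n, (sumι X n).f m ≫ U = (sumShiftPartial S N n).f m := fun n => sumι_descX _ n
    have hT : ∀ n, (sumι X n).f m ≫ (sumShift S).f m = (S n).f m ≫ (sumι X (n + 1)).f m :=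
      fun n => by rw [← HomologicalComplex.comp_f, sumShift, sumι_desc]; rfl
    refine ⟨U, sumComplex_X_hom_ext fun n => ?_, sumComplex_X_hom_ext fun n => ?_⟩
    · rw [← Category.assoc, HomologicalComplex.sub_f_apply, Preadditive.comp_sub,
        Preadditive.sub_comp, HomologicalComplex.id_f, Category.comp_id, hU, hT, Category.assoc,
        hU, ← stab N n (by omega), sumShiftPartial]
      simp
    · have e := congrArg (fun z => z.f m) (sumShiftPartial_succ' (S := S) N n)
      simp only [HomologicalComplex.add_f_apply, HomologicalComplex.comp_f] at e
      rw [stab N n (by omega)] at e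
      rw [← Category.assoc, hU, HomologicalComplex.sub_f_apply, Preadditive.comp_sub,
        HomologicalComplex.id_f, Category.comp_id, Category.comp_id]
      exact sub_eq_of_eq_add e
  exact HomologicalComplex.Hom.isIso_of_components _

variable [HasDerivedCategory.{w₃} A] [HasExactColimitsOfShape (Discrete ℕ) A]

/-- If every map from `X n` to `G` factors through `X (n + 1)` and the sequence is eventually zero
in each degree, then there are no maps from `X n` to `G`. -/
theorem eq_zero_of_telescope (h : ∀ m : ℤ, ∃ N, ∀ n, N ≤ n → IsZero ((X n).X m))
    {G : DerivedCategory A}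
    (hG : ∀ n (f : Q.obj (X n) ⟶ G), ∃ g : Q.obj (X (n + 1)) ⟶ G, f = Q.map (S n) ≫ g)
    (f : Q.obj (X 0) ⟶ G) : f = 0 := by
  choose g hg using hG
  -- Successive factorizations of `f` give a compatible family on the whole sequence.
  let F : ∀ n, Q.obj (X n) ⟶ G := fun n => Nat.rec f g n
  have hF : ∀ n, F n = Q.map (S n) ≫ F (n + 1) := fun n => hg n (F n)
  obtain ⟨Φ, hΦ⟩ := exists_sum_desc F
  have := isIso_one_sub_sumShift (S := S) h
  -- Compatibility of the family says exactly that `Φ` is invariant under the shift; as `1 -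
  -- sumShift` is invertible, `Φ` vanishes.
  have e : Q.map (𝟙 _ - sumShift S) ≫ Φ = 0 := by
    refine sum_Q_hom_ext fun n => ?_
    rw [Q.map_sub, Q.map_id, Preadditive.sub_comp, Category.id_comp, Preadditive.comp_sub, hΦ,
      ← Category.assoc, ← Q.map_comp, sumShift, sumι_desc, Q.map_comp, Category.assoc, hΦ, ← hF,
      sub_self, comp_zero]
  rw [Preadditive.IsIso.comp_left_eq_zero] at e
  have := hΦ 0
  rw [e, comp_zero] at this
  exact this.symm

end Telescope

/-! ### Subcomplexes and quotients given by ranges of powers of `u` -/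

section Transfer

variable {k R : SimplicialObject CommRingCat.{u}} {φ : k ⟶ R}

/-- The total chain degree and the cohomological degree determine the power of `u`. -/
lemma inRange_iff {I : Set ℤ} {n p : ℤ} {i j : ℕ} (h : (i : ℤ) + j + n = 2 * p) :
    InRange I n i j ↔ p ∈ I := by
  refine ⟨fun ⟨q, hq, e⟩ => ?_, fun hp => ⟨p, hp, h⟩⟩
  have : p = q := by omega
  rwa [this]

lemma cycGroup_ext {I : Set ℤ} {n : ℤ} {S : Under R} {x y : cycGroup φ I n S}
    (h : ∀ i j, x.1 i j = y.1 i j) : x = y :=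
  Subtype.ext (funext fun i => funext fun j => h i j)

lemma cycGroup_eq_zero {I : Set ℤ} {n : ℤ} {S : Under R} (x : cycGroup φ I n S) {i j : ℕ}
    (h : ¬ InRange I n i j) : x.1 i j = 0 :=
  x.2 i j h

variable (φ)

open scoped Classical in
/-- The map `∏_{p ∈ I} M u ^ p → ∏_{p ∈ J} M u ^ p` that is the identity on the terms with
`p ∈ I ∩ J` and zero on the others. -/
noncomputable def transfer (I J : Set ℤ) (n : ℤ) (S : Under R) :
    cycGroup φ I n S →+ cycGroup φ J n S where
  toFun x := ⟨fun i j => if InRange J n i j then x.1 i j else 0, fun _ _ h => if_neg h⟩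
  map_zero' := cycGroup_ext fun _ _ => ite_self _
  map_add' x y := cycGroup_ext fun i j => by
    change (if _ then x.1 i j + y.1 i j else 0) = (if _ then _ else 0) + (if _ then _ else 0)
    split_ifs
    · rfl
    · exact (add_zero _).symm

variable {φ}

lemma transfer_apply {I J : Set ℤ} {n : ℤ} {S : Under R} (x : cycGroup φ I n S) {i j : ℕ}
    (h : InRange J n i j) : (transfer φ I J n S x).1 i j = x.1 i j := if_pos h

lemma transfer_apply_of_subset {I J : Set ℤ} (hIJ : I ⊆ J) {n : ℤ} {S : Under R}
    (x : cycGroup φ I n S) (i j : ℕ) : (transfer φ I J n S x).1 i j = x.1 i j := by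
  by_cases h : InRange J n i j
  · exact transfer_apply x h
  · exact ((transfer φ I J n S x).2 i j h).trans (x.2 i j fun h' => h (h'.mono hIJ)).symm

lemma transfer_transfer {I J K : Set ℤ} (h : I ∩ K ⊆ J) {n : ℤ} {S : Under R}
    (x : cycGroup φ I n S) :
    transfer φ J K n S (transfer φ I J n S x) = transfer φ I K n S x := by
  refine cycGroup_ext fun i j => ?_
  by_cases hK : InRange K n i j
  · rw [transfer_apply _ hK, transfer_apply _ hK]
    by_cases hJ : InRange J n i j
    · exact transfer_apply _ hJ
    · rw [(transfer φ I J n S x).2 i j hJ, x.2 i j]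
      rintro ⟨p, hp, e⟩
      exact hJ ⟨p, h ⟨hp, (inRange_iff e).1 hK⟩, e⟩
  · rw [(transfer φ J K n S _).2 i j hK, (transfer φ I K n S x).2 i j hK]

lemma transfer_self {I : Set ℤ} {n : ℤ} {S : Under R} (x : cycGroup φ I n S) :
    transfer φ I I n S x = x :=
  cycGroup_ext (transfer_apply_of_subset subset_rfl x)

lemma transfer_eq_zero {I J : Set ℤ} (h : Disjoint I J) {n : ℤ} {S : Under R}
    (x : cycGroup φ I n S) : transfer φ I J n S x = 0 := by
  refine cycGroup_ext fun i j => ?_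
  by_cases hJ : InRange J n i j
  · rw [transfer_apply _ hJ]
    refine x.2 i j ?_
    rintro ⟨p, hp, e⟩
    exact h.le_bot ⟨hp, (inRange_iff e).1 hJ⟩
  · exact (transfer φ I J n S x).2 i j hJ

/-- The condition under which `transfer` is compatible with the differentials. -/
structure IsTransfer (I J : Set ℤ) : Prop where
  sub : ∀ p, p ∈ I → p ∈ J → p + 1 ∈ J → p + 1 ∈ I
  quot : ∀ p, p ∈ I → p + 1 ∈ I → p + 1 ∈ J → p ∈ J

/-- The terms `b` and `d` preserve the power of `u`, so only `uB` can fail to commute. Its component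
from `u^p` to `u^(p+1)` survives on one side if `p ∈ I ∩ J` and `p + 1 ∈ J`, on the other if `p, p +
1 ∈ I` and `p + 1 ∈ J`; the two clauses of `IsTransfer` equate these conditions. -/
lemma cycD_transfer {I J : Set ℤ} (hIJ : IsTransfer I J) (n : ℤ) (S : Under R)
    (x : cycGroup φ I n S) :
    cycD φ J n S (transfer φ I J n S x) = transfer φ I J (n + 1) S (cycD φ I n S x) := by
  refine cycGroup_ext fun i j => ?_
  by_cases hJ : InRange J (n + 1) i j
  swap
  · exact (cycGroup_eq_zero _ hJ).trans (cycGroup_eq_zero (transfer φ I J (n + 1) S _) hJ).symm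
  rw [cycD_apply _ hJ, transfer_apply _ hJ]
  obtain ⟨p, hp, e⟩ := id hJ
  have e₁ : (transfer φ I J n S x).1 (i + 1) j = x.1 (i + 1) j := transfer_apply x (inRange_b hJ)
  have e₂ : (transfer φ I J n S x).1 i (j + 1) = x.1 i (j + 1) := transfer_apply x (inRange_d hJ)
  -- Outside the range of `I` the right-hand side is zero, so a contribution of `B` on the left
  -- would have to come from `p - 1 ∈ I ∩ J`; `IsTransfer.sub` excludes this.
  have key : InRange I (n + 1) i j ∨ connesPart φ S (transfer φ I J n S x).1 i j = 0 := by
    cases i with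
    | zero => exact Or.inr rfl
    | succ i =>
      have e' : (i : ℤ) + j + n = 2 * (p - 1) := by push_cast at e; linarith
      by_cases hp' : p - 1 ∈ I ∧ p - 1 ∈ J
      · have := hIJ.sub _ hp'.1 hp'.2
        rw [sub_add_cancel] at this
        exact Or.inl ⟨p, this hp, e⟩
      · right
        have h₀ : (transfer φ I J n S x).1 i j = 0 := by
          by_cases h : InRange J n i j
          · rw [transfer_apply x h]
            exact x.2 i j fun h' => hp' ⟨(inRange_iff e').1 h', (inRange_iff e').1 h⟩
          · exact cycGroup_eq_zero _ h
        change chainsOp φ (connesB i) S j ((transfer φ I J n S x).1 i j) = 0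
        rw [h₀, map_zero]
  by_cases hI : InRange I (n + 1) i j
  · rw [cycD_apply _ hI, totalD, totalD, e₁, e₂]
    congr 1
    cases i with
    | zero => rfl
    | succ i =>
      have e' : (i : ℤ) + j + n = 2 * (p - 1) := by push_cast at e; linarith
      change chainsOp φ (connesB i) S j ((transfer φ I J n S x).1 i j) =
        chainsOp φ (connesB i) S j (x.1 i j)
      congr 1
      by_cases h : InRange J n i j
      · exact transfer_apply x h
      · have h' : (transfer φ I J n S x).1 i j = 0 := cycGroup_eq_zero _ h
        rw [h', x.2 i j]
        intro h''
        refine h ((inRange_iff e').2 (hIJ.quot _ ((inRange_iff e').1 h'') ?_ ?_))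
        · rw [sub_add_cancel]
          exact (inRange_iff e).1 hI
        · rwa [sub_add_cancel]
  · rw [totalD, e₁, e₂, key.resolve_left hI, x.2 (i + 1) j fun h => hI (inRange_b' h),
      x.2 i (j + 1) fun h => hI (inRange_d' h), map_zero, map_zero, smul_zero, add_zero, add_zero]
    exact (cycGroup_eq_zero (cycD φ I n S x) hI).symm

variable (φ)

noncomputable def transferObj (I J : Set ℤ) (n : ℤ) : cycObj φ I n ⟶ cycObj φ J n where
  app S := AddCommGrpCat.ofHom (transfer φ I J n S)
  naturality S S' w := by
    ext x
    refine cycGroup_ext fun i j => ?_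
    by_cases hJ : InRange J n i j
    · refine (transfer_apply (cycMap I n w x) hJ).trans ?_
      exact (congrArg (chainsMap φ w i j) (transfer_apply x hJ)).symm
    · exact (cycGroup_eq_zero (transfer φ I J n S' (cycMap I n w x)) hJ).trans
        (cycGroup_eq_zero (cycMap J n w (transfer φ I J n S x)) hJ).symm

lemma transferObj_comp {I J K : Set ℤ} (h : I ∩ K ⊆ J) (n : ℤ) :
    transferObj φ I J n ≫ transferObj φ J K n = transferObj φ I K n := by
  ext S x
  exact transfer_transfer h x

lemma transferObj_self (I : Set ℤ) (n : ℤ) : transferObj φ I I n = 𝟙 _ := by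
  ext S x
  exact transfer_self x

lemma transferObj_eq_zero {I J : Set ℤ} (h : Disjoint I J) (n : ℤ) :
    transferObj φ I J n = 0 := by
  ext S x
  exact transfer_eq_zero h x

lemma transferObj_add {I J K : Set ℤ} (hI : I ⊆ J) (hK : ∀ p, p ∈ K ↔ p ∈ J ∧ p ∉ I) (n : ℤ) :
    transferObj φ J I n ≫ transferObj φ I J n + transferObj φ J K n ≫ transferObj φ K J n =
      𝟙 _ := by
  have hKJ : K ⊆ J := fun p hp => ((hK p).1 hp).1
  ext S x
  refine cycGroup_ext fun i j => ?_
  change (transfer φ I J n S (transfer φ J I n S x)).1 i j +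
    (transfer φ K J n S (transfer φ J K n S x)).1 i j = x.1 i j
  rw [transfer_apply_of_subset hI, transfer_apply_of_subset hKJ]
  by_cases h : InRange I n i j
  · obtain ⟨p, hp, e⟩ := id h
    have h' : (transfer φ J K n S x).1 i j = 0 :=
      cycGroup_eq_zero _ fun h' => ((hK p).1 ((inRange_iff e).1 h')).2 hp
    rw [transfer_apply x h, h', add_zero]
  · have h₀ : (transfer φ J I n S x).1 i j = 0 := cycGroup_eq_zero _ h
    rw [h₀, zero_add]
    by_cases h' : InRange K n i j
    · exact transfer_apply x h'
    · have h₁ : (transfer φ J K n S x).1 i j = 0 := cycGroup_eq_zero _ h'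
      rw [h₁, x.2 i j]
      rintro ⟨p, hp, e⟩
      exact h' ⟨p, (hK p).2 ⟨hp, fun hp' => h ⟨p, hp', e⟩⟩, e⟩

variable {φ} in
noncomputable def transferComplex {I J : Set ℤ} (h : IsTransfer I J) :
    cycComplex φ I ⟶ cycComplex φ J :=
  CochainComplex.ofHom (transferObj φ I J) (fun n => by
    rw [cycComplex_d, cycComplex_d]
    ext S x
    exact cycD_transfer h n S x)

variable {I J K : Set ℤ}

/-- Since `uB` raises the power of `u`, a set `I` that is closed under successors inside `J` gives a
subcomplex; `IsTransfer.of_quot` treats the corresponding quotient. -/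
lemma IsTransfer.of_sub (hI : I ⊆ J) (hup : ∀ p ∈ I, p + 1 ∈ J → p + 1 ∈ I) :
    IsTransfer I J where
  sub p hp _ hp' := hup p hp hp'
  quot _ hp _ _ := hI hp

lemma IsTransfer.of_quot (hK : ∀ p, p ∈ K ↔ p ∈ J ∧ p ∉ I)
    (hup : ∀ p ∈ I, p + 1 ∈ J → p + 1 ∈ I) : IsTransfer J K where
  sub _ _ _ hp := ((hK _).1 hp).1
  quot p hp _ hp'' := (hK p).2 ⟨hp, fun h => ((hK _).1 hp'').2 (hup p h ((hK _).1 hp'').1)⟩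

/-- The short exact sequence `0 → ∏_{p ∈ I} M u ^ p → ∏_{p ∈ J} M u ^ p → ∏_{p ∈ K} M u ^ p → 0`
for `J = I ⊔ K`. -/
lemma exists_shortExact (hI : I ⊆ J) (hK : ∀ p, p ∈ K ↔ p ∈ J ∧ p ∉ I)
    (hup : ∀ p ∈ I, p + 1 ∈ J → p + 1 ∈ I) :
    ∃ w, (ShortComplex.mk (transferComplex (φ := φ) (.of_sub hI hup))
    (transferComplex (.of_quot hK hup)) w).ShortExact := by
  have hIK : Disjoint I K := Set.disjoint_left.2 fun p hp hp' => ((hK p).1 hp').2 hp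
  have hKJ : K ⊆ J := fun p hp => ((hK p).1 hp).1
  have w : ∀ n, transferObj φ I J n ≫ transferObj φ J K n = 0 := fun n => by
    rw [transferObj_comp φ (Set.inter_subset_left.trans hI), transferObj_eq_zero φ hIK]
  refine ⟨by ext n : 1; exact w n, HomologicalComplex.shortExact_of_degreewise_shortExact _
    fun n => ?_⟩
  -- The splitting consists of the transfers in the opposite directions. It is only used degreewise,
  -- as these need not commute with the differentials.
  have s : (ShortComplex.mk (transferObj φ I J n) (transferObj φ J K n) (w n)).Splitting :=
    { r := transferObj φ J I n
      s := transferObj φ K J n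
      f_r := by rw [transferObj_comp φ (Set.inter_subset_left.trans hI), transferObj_self]
      s_g := by rw [transferObj_comp φ (Set.inter_subset_left.trans hKJ), transferObj_self]
      id := transferObj_add φ hI hK n }
  exact s.shortExact

end Transfer

/-! ### Bracketed elements in the bar construction of free algebras -/

section BarElements

/-- The variable `[a]` of `k[k[⋯k[A]⋯]]`. -/
noncomputable def barVar {A : Arrow CommRingCat.{u}} {n : ℕ} (a : (barObj freeComonad A n).right) :
    (barObj freeComonad A (n + 1)).right :=
  freeVar a

/-- The element `[[⋯[a]⋯]]` of `k[k[⋯k[A]⋯]]`. -/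
noncomputable def nestedVar {A : Arrow CommRingCat.{u}} (a : A.right) :
    ∀ n, (barObj freeComonad A n).right
  | 0 => a
  | n + 1 => barVar (nestedVar a n)

/-- The integer `c ∈ k[⋯k[A]⋯]`, in `w` nested brackets. -/
noncomputable def bracketed (A : Arrow CommRingCat.{u}) (c : ℤ) :
    ∀ _ n : ℕ, (barObj freeComonad A n).right
  | 0, _ => (c : CommRingCat.carrier _)
  | _ + 1, 0 => (c : CommRingCat.carrier _)
  | w + 1, n + 1 => barVar (bracketed A c w n)

lemma bracketed_self (A : Arrow CommRingCat.{u}) (c : ℤ) (n : ℕ) :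
    bracketed A c n n = nestedVar (c : A.right) n := by
  induction n with
  | zero => rw [bracketed]; rfl
  | succ n ih => rw [bracketed, ih]; rfl

lemma barLift_right_barVar {A A' : Arrow CommRingCat.{u}} {m n : ℕ}
    (f : barObj freeComonad A m ⟶ barObj freeComonad A' n) (a : (barObj freeComonad A m).right) :
    (barLift freeComonad f).right.hom (barVar a) = barVar (f.right.hom a) :=
  freeMap_var f a

lemma barCounit_right_barVar {A : Arrow CommRingCat.{u}} {n : ℕ}
    (a : (barObj freeComonad A n).right) :
    (barCounit freeComonad A n).right.hom (barVar a) = a :=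
  freeCounit_var _ a

lemma barComult_right_barVar {A : Arrow CommRingCat.{u}} {n : ℕ}
    (a : (barObj freeComonad A n).right) :
    (barComult freeComonad A n).right.hom (barVar a) = barVar (barVar a) :=
  freeComult_var _ a

/-- The counit strips a bracket and the comultiplication doubles one, so a fully bracketed element
stays fully bracketed. -/
lemma barMap_nestedVar {A : Arrow CommRingCat.{u}} (x : A.right) (a b : ℕ) (f : Fin a →o Fin b) :
    (barMap freeComonad A a b f).right.hom (nestedVar x b) = nestedVar x a := by
  induction hN : a + b using Nat.strong_induction_on generalizing a b with
  | _ N ih =>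
  subst hN
  cases b with
  | zero =>
    cases a with
    | succ a => exact (f 0).elim0
    | zero => rw [barMap]; rfl
  | succ b =>
    by_cases hf : ∀ i, f i ≠ 0
    · rw [barMap_skip _ _ _ _ f hf, comp_right_apply, nestedVar, barCounit_right_barVar]
      exact ih _ (by omega) _ _ _ rfl
    · cases a with
      | zero => exact absurd (fun i : Fin 0 => i.elim0) hf
      | succ a =>
        have hf0 : f 0 = 0 := by
          by_contra h
          exact hf (ne_zero_of_head f h)
        rw [barMap_head _ _ _ _ f hf0, comp_right_apply, nestedVar, barComult_right_barVar,
          barLift_right_barVar, nestedVar]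
        congr 1
        exact ih (a + (b + 1)) (by omega) _ _ (tailHom f) rfl

/-- The number `w` encodes a cut of `{0, …, b - 1}` into an initial segment and its complement, and
`h` says that the cut at `w'` is its preimage under `f`. This is how simplicial operators act on the
simplices of `Δ¹`. The bound on `w'` ensures that `h` determines it. -/
lemma barMap_bracketed {A : Arrow CommRingCat.{u}} (c : ℤ) (a b : ℕ) (f : Fin a →o Fin b)
    {w w' : ℕ} (hw' : w' ≤ a) (h : ∀ i : Fin a, (i : ℕ) < w' ↔ (f i : ℕ) < w) :
    (barMap freeComonad A a b f).right.hom (bracketed A c w b) = bracketed A c w' a := by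
  cases w with
  | zero =>
    have : w' = 0 := by
      by_contra h'
      exact Nat.not_lt_zero _ ((h ⟨0, by omega⟩).1 (Nat.pos_of_ne_zero h'))
    rw [this, bracketed, bracketed]
    exact map_intCast _ c
  | succ w =>
  induction hN : a + b using Nat.strong_induction_on generalizing a b w w' with
  | _ N ih =>
  subst hN
  cases b with
  | zero =>
    cases a with
    | succ a => exact (f 0).elim0
    | zero =>
      rw [show w' = 0 by omega, barMap, bracketed, bracketed]
      rfl
  | succ b =>
    by_cases hf : ∀ i, f i ≠ 0
    -- The value `0` is missed, so the outer bracket is stripped; `w` drops by one and `w'` stays.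
    · rw [barMap_skip _ _ _ _ f hf, comp_right_apply, bracketed, barCounit_right_barVar]
      have h' : ∀ i : Fin a, (i : ℕ) < w' ↔ (predHom f hf i : ℕ) < w := fun i => by
        have h₁ : (predHom f hf i : ℕ) = f i - 1 := rfl
        have h₂ : (f i : ℕ) ≠ 0 := fun e => hf i (Fin.ext e)
        rw [h i, h₁]
        omega
      cases w with
      | zero =>
        have : w' = 0 := by
          by_contra h''
          exact Nat.not_lt_zero _ ((h' ⟨0, by omega⟩).1 (Nat.pos_of_ne_zero h''))
        rw [this, bracketed, bracketed]
        exact map_intCast _ c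
      | succ w => exact ih _ (by omega) _ _ _ hw' w h' rfl
    · cases a with
      | zero => exact absurd (fun i : Fin 0 => i.elim0) hf
      | succ a =>
        have hf0 : f 0 = 0 := by
          by_contra h
          exact hf (ne_zero_of_head f h)
        obtain _ | w' := w'
        · exact absurd ((h 0).2 (by rw [hf0]; exact Nat.succ_pos w)) (Nat.lt_irrefl 0)
        -- The outer bracket is doubled; one copy is the outer bracket of the result and the other
        -- is passed to the tail of `f`, so that `w'` drops by one and `w` stays.
        rw [barMap_head _ _ _ _ f hf0, comp_right_apply, bracketed, barComult_right_barVar,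
          barLift_right_barVar, bracketed]
        congr 1
        have := ih (a + (b + 1)) (by omega) _ _ (tailHom f) (w' := w') (by omega) w
          (fun i => by
            have h₁ := h i.succ
            rw [Fin.val_succ] at h₁
            have h₂ : (tailHom f i : ℕ) = f i.succ := rfl
            rw [h₂, ← h₁]
            omega) rfl
        rwa [bracketed] at this

lemma barObjMap_nestedVar {A A' : Arrow CommRingCat.{u}} (w : A ⟶ A') (a : A.right) (n : ℕ) :
    (barObjMap freeComonad w n).right.hom (nestedVar a n) = nestedVar (w.right.hom a) n := by
  induction n with
  | zero => rfl
  | succ n ih => rw [barObjMap, nestedVar, barLift_right_barVar, ih, nestedVar]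

lemma barObjMap_bracketed {A A' : Arrow CommRingCat.{u}} (v : A ⟶ A') (c : ℤ) (w n : ℕ) :
    (barObjMap freeComonad v n).right.hom (bracketed A c w n) = bracketed A' c w n := by
  induction n generalizing w with
  | zero => cases w <;> exact map_intCast _ c
  | succ n ih =>
    cases w with
    | zero =>
      rw [bracketed, bracketed]
      exact map_intCast _ c
    | succ w => rw [barObjMap, bracketed, barLift_right_barVar, ih, bracketed]

end BarElements

/-! ### Multiplication on the zeroth tensor factor -/

section HochMul

/-- The multiplication by an element on the tensor factor with index `0`. -/
noncomputable def hochMul (i : ℕ) (f : Arrow CommRingCat.{u}) (q : f.right) :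
    (hoch.{u} i).obj f ⟶ (hoch.{u} i).obj f :=
  AddCommGrpCat.uliftFunctor.{u + 1, u}.map
    (AddCommGrpCat.ofHom (X := tensorObj (i + 1) f) (Y := tensorObj (i + 1) f)
      (AddMonoidHom.mulLeft ((tensorInj f (0 : Fin (i + 1))).hom q)))

lemma hochMul_naturality (i : ℕ) {f g : Arrow CommRingCat.{u}} (w : f ⟶ g) (q : f.right) :
    hochMul i f q ≫ (hoch i).map w = (hoch i).map w ≫ hochMul i g (w.right.hom q) := by
  ext x
  refine ULift.ext _ _ ?_
  refine (map_mul (tensorArrowMap (i + 1) w).hom _ _).trans ?_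
  refine congrArg (· * _) ?_
  exact congrArg (fun z => z.hom q)
    (tensorInj_desc (w.left ≫ tensorHead (i + 1) g) (fun j => w.right ≫ tensorInj g j) _ 0)

/-- An index map that fixes `0` sends the zeroth factor into the zeroth factor, and it induces a
ring homomorphism. -/
lemma hochMul_hochMap {m n : ℕ} (θ : Fin (m + 1) → Fin (n + 1)) (hθ : θ 0 = 0)
    (f : Arrow CommRingCat.{u}) (q : f.right) :
    hochMul m f q ≫ (hochMap θ).app f = (hochMap θ).app f ≫ hochMul n f q := by
  ext x
  refine ULift.ext _ _ ?_
  refine (map_mul (tensorIndexMap θ f).hom _ _).trans ?_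
  refine congrArg (· * _) ?_
  refine (congrArg (fun z => z.hom q)
    (tensorInj_desc (tensorHead (n + 1) f) (fun j => tensorInj f (θ j)) _ 0)).trans ?_
  rw [hθ]

/-- All faces fix position `0`, including the last one, which multiplies the last entry into the
zeroth. -/
lemma hochMul_hochB (n : ℕ) (f : Arrow CommRingCat.{u}) (q : f.right) :
    hochMul (n + 1) f q ≫ (hochB n).app f = (hochB n).app f ≫ hochMul n f q := by
  have h : ∀ i, hochMul (n + 1) f q ≫ (hochFace n i).app f =
      (hochFace n i).app f ≫ hochMul n f q := fun i =>
    hochMul_hochMap _ (Fin.ext (by simp [faceIdx])) f q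
  rw [hochB]
  simp only [NatTrans.app_sum, NatTrans.app_zsmul, Preadditive.comp_sum, Preadditive.sum_comp,
    Preadditive.comp_zsmul, Preadditive.zsmul_comp, h]

lemma hochMul_one (i : ℕ) (f : Arrow CommRingCat.{u}) : hochMul i f 1 = 𝟙 _ := by
  ext x
  refine ULift.ext _ _ ?_
  exact (congrArg (· * _) (map_one (tensorInj f (0 : Fin (i + 1))).hom)).trans (one_mul _)

lemma hochMul_sub (i : ℕ) (f : Arrow CommRingCat.{u}) (q q' : f.right) :
    hochMul i f (q - q') = hochMul i f q - hochMul i f q' := by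
  ext x
  refine ULift.ext _ _ ?_
  exact (congrArg (· * _) (map_sub (tensorInj f (0 : Fin (i + 1))).hom q q')).trans (sub_mul _ _ _)

end HochMul

/-! ### The homotopy between `1` and `[⋯[1]⋯] - [⋯[0]⋯]` in the resolution -/

section ResolutionElements

open Opposite Simplicial

variable {k R : SimplicialObject CommRingCat.{u}} (φ : k ⟶ R)

/-- The difference of the elements `1` and `0`, in `w` nested brackets, of the resolution. -/
noncomputable def bracketDiff (S : Under R) (w : ℕ) (n : SimplexCategoryᵒᵖ) :
    (((resolution φ).obj S).obj n).right :=
  (bracketed ((structureArrow φ S).obj n) 1 w (n.unop.len + 1) -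
    bracketed ((structureArrow φ S).obj n) 0 w (n.unop.len + 1) :
      (barObj freeComonad ((structureArrow φ S).obj n) (n.unop.len + 1)).right)

lemma bracketDiff_zero (S : Under R) (n : SimplexCategoryᵒᵖ) : bracketDiff φ S 0 n = 1 := by
  rw [bracketDiff, bracketed, bracketed, Int.cast_one, Int.cast_zero, sub_zero]
  rfl

variable {φ}

/-- An operator on the diagonal first acts on the coefficients, where integers are preserved, and
then on the brackets as in `barMap_bracketed`. -/
lemma resolution_map_bracketDiff {S : Under R} {m n : SimplexCategoryᵒᵖ} (θ : m ⟶ n) {w w' : ℕ}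
    (hw' : w' ≤ n.unop.len + 1)
    (h : ∀ i : Fin (n.unop.len + 1), (i : ℕ) < w' ↔ (θ.unop.toOrderHom i : ℕ) < w) :
    (((resolution φ).obj S).map θ).right.hom (bracketDiff φ S w m) = bracketDiff φ S w' n := by
  have key : ∀ c : ℤ, (((resolution φ).obj S).map θ).right.hom
      (bracketed ((structureArrow φ S).obj m) c w (m.unop.len + 1)) =
      bracketed ((structureArrow φ S).obj n) c w' (n.unop.len + 1) := fun c =>
    (congrArg (barMap freeComonad ((structureArrow φ S).obj n) (n.unop.len + 1) (m.unop.len + 1)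
      θ.unop.toOrderHom).right.hom (barObjMap_bracketed ((structureArrow φ S).map θ) c w _)).trans
      (barMap_bracketed c _ _ _ hw' h)
  exact (map_sub (((resolution φ).obj S).map θ).right.hom _ _).trans
    (congrArg₂ (· - ·) (key 1) (key 0))

lemma resolution_app_bracketDiff {S S' : Under R} (v : S ⟶ S') (w : ℕ) (n : SimplexCategoryᵒᵖ) :
    (((resolution φ).map v).app n).right.hom (bracketDiff φ S w n) = bracketDiff φ S' w n :=
  (map_sub (((resolution φ).map v).app n).right.hom _ _).trans (congrArg₂ (· - ·)
    (barObjMap_bracketed ((structureArrowMap φ v).app n) 1 w _)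
    (barObjMap_bracketed ((structureArrowMap φ v).app n) 0 w _))

lemma resolution_map_nestedVar {S : Under R} {m n : SimplexCategoryᵒᵖ} (θ : m ⟶ n)
    (a : S.right.obj m) :
    (((resolution φ).obj S).map θ).right.hom
        (nestedVar (A := (structureArrow φ S).obj m) a (m.unop.len + 1)) =
      nestedVar (A := (structureArrow φ S).obj n) ((S.right.map θ).hom a) (n.unop.len + 1) :=
  (congrArg (barMap freeComonad ((structureArrow φ S).obj n) (n.unop.len + 1) (m.unop.len + 1)
    θ.unop.toOrderHom).right.hom (barObjMap_nestedVar ((structureArrow φ S).map θ) a _)).trans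
    (barMap_nestedVar _ _ _ _)

lemma resolution_app_nestedVar {S S' : Under R} (v : S ⟶ S') {n : SimplexCategoryᵒᵖ}
    (a : S.right.obj n) :
    (((resolution φ).map v).app n).right.hom
        (nestedVar (A := (structureArrow φ S).obj n) a (n.unop.len + 1)) =
      nestedVar (A := (structureArrow φ S').obj n) ((v.right.app n).hom a) (n.unop.len + 1) :=
  barObjMap_nestedVar ((structureArrowMap φ v).app n) a _

variable (φ) in
/-- The simplicial abelian group `Q^{⊗ (i + 1)}`, where `Q` is the resolution of `S`. -/
noncomputable abbrev hochRes (S : Under R) (i : ℕ) : SimplicialObject AddCommGrpCat.{u + 1} :=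
  ((SimplicialObject.whiskering _ _).obj (hoch i)).obj ((resolution φ).obj S)

variable (φ) in
noncomputable def bracketMul (S : Under R) (i w : ℕ) (n : SimplexCategoryᵒᵖ) :
    (hochRes φ S i).obj n ⟶ (hochRes φ S i).obj n :=
  hochMul i (((resolution φ).obj S).obj n) (bracketDiff φ S w n)

lemma bracketMul_zero (S : Under R) (i : ℕ) (n : SimplexCategoryᵒᵖ) :
    bracketMul φ S i 0 n = 𝟙 _ := by
  rw [bracketMul, bracketDiff_zero, hochMul_one]
  rfl

lemma bracketMul_map {S : Under R} {i : ℕ} {m n : SimplexCategoryᵒᵖ} (θ : m ⟶ n) {w w' : ℕ}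
    (hw' : w' ≤ n.unop.len + 1) (h : ∀ i : Fin (n.unop.len + 1), (i : ℕ) < w' ↔ (θ.unop.toOrderHom i : ℕ) < w) :
    bracketMul φ S i w m ≫ (hochRes φ S i).map θ =
      (hochRes φ S i).map θ ≫ bracketMul φ S i w' n := by
  rw [bracketMul, bracketMul, ← resolution_map_bracketDiff θ hw' h]
  exact hochMul_naturality i (((resolution φ).obj S).map θ) _

/-- The preimage of the initial segment of length `w` under the coface that omits `j` loses a point
exactly when `j < w`. -/
lemma bracketMul_δ {S : Under R} {i n : ℕ} (j : Fin (n + 2)) {w w' : ℕ} (hw' : w' ≤ n + 1)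
    (h : w' = if (j : ℕ) < w then w - 1 else w) :
    bracketMul φ S i w (op ⦋n + 1⦌) ≫ (hochRes φ S i).δ j =
      (hochRes φ S i).δ j ≫ bracketMul φ S i w' (op ⦋n⦌) :=
  bracketMul_map (SimplexCategory.δ j).op hw' fun l => by
    change (l : ℕ) < w' ↔ ((Fin.succAbove j l : Fin (n + 2)) : ℕ) < w
    rw [Fin.succAbove]
    split_ifs at h ⊢ <;> simp_all [Fin.lt_def] <;> omega

/-- The preimage of the initial segment of length `w` under the codegeneracy that repeats `j` gains
a point exactly when `j < w`. -/
lemma bracketMul_σ {S : Under R} {i n : ℕ} (j : Fin (n + 1)) {w w' : ℕ} (hw' : w' ≤ n + 2)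
    (h : w' = if (j : ℕ) < w then w + 1 else w) :
    bracketMul φ S i w (op ⦋n⦌) ≫ (hochRes φ S i).σ j =
      (hochRes φ S i).σ j ≫ bracketMul φ S i w' (op ⦋n + 1⦌) :=
  bracketMul_map (SimplexCategory.σ j).op hw' fun l => by
    change (l : ℕ) < w' ↔ ((Fin.predAbove j l : Fin (n + 1)) : ℕ) < w
    have e : ((Fin.predAbove j l : Fin (n + 1)) : ℕ) = if (j : ℕ) < l then (l : ℕ) - 1 else l := by
      rw [Fin.predAbove]
      split_ifs with h₁ h₂ h₂
      · rfl
      · exact absurd h₁ h₂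
      · exact absurd h₂ h₁
      · rfl
    rw [e]
    split_ifs at h ⊢ <;> omega

variable (φ)

/-- The endomorphism of `Q^{⊗ (i + 1)}` given by multiplication by `[⋯[1]⋯] - [⋯[0]⋯]`. -/
noncomputable def bracketEnd (S : Under R) (i : ℕ) : hochRes φ S i ⟶ hochRes φ S i where
  app n := bracketMul φ S i (n.unop.len + 1) n
  naturality _ _ θ := (bracketMul_map θ le_rfl fun l =>
    ⟨fun _ => (θ.unop.toOrderHom l).2, fun _ => l.2⟩).symm

/-- In the simplicial ring `Q`, the elements `1` and `[⋯[1]⋯] - [⋯[0]⋯]` are homotopic. -/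
noncomputable def bracketHomotopy (S : Under R) (i : ℕ) :
    SimplicialObject.Homotopy (bracketEnd φ S i) (𝟙 _) where
  -- The cut at `j + 1` in degree `n + 1` separates the two copies of `j` made by the degeneracy.
  -- The first face of `h 0` then has no brackets left, giving `1`, and the last face of the last
  -- `h` is fully bracketed.
  h {n} j := (hochRes φ S i).σ j ≫ bracketMul φ S i (j + 1) (op ⦋n + 1⦌)
  h_zero_comp_δ_zero n := by
    rw [Category.assoc, bracketMul_δ (w' := 0) 0 (by omega) (by simp), bracketMul_zero,
      Category.comp_id]
    exact (hochRes φ S i).δ_comp_σ_self (i := (0 : Fin (n + 1)))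
  h_last_comp_δ_last n := by
    rw [Category.assoc, bracketMul_δ (w' := n + 1) _ le_rfl (by simp), ← Category.assoc]
    have h := (hochRes φ S i).δ_comp_σ_succ (i := Fin.last n)
    rw [Fin.succ_last] at h
    rw [h, Category.id_comp]
    rfl
  h_succ_comp_δ_castSucc_of_lt {n} l j hij := by
    have hl : (l : ℕ) ≤ j := hij
    have := j.2
    rw [Category.assoc, bracketMul_δ (w' := j + 1) _ (by omega)
      (by rw [if_pos (by simp; omega)]; simp), ← Category.assoc, ← Category.assoc,
      SimplicialObject.δ_comp_σ_of_le _ hij]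
  h_succ_comp_δ_castSucc_succ {n} j := by
    have := j.2
    have h₁ := (hochRes φ S i).δ_comp_σ_self (i := j.succ)
    have h₂ := (hochRes φ S i).δ_comp_σ_succ (i := j.castSucc)
    rw [← Fin.succ_castSucc] at h₁
    rw [Category.assoc, Category.assoc, bracketMul_δ (w' := j + 1) _ (by omega) (by simp),
      bracketMul_δ (w' := j + 1) _ (by omega) (by simp), reassoc_of% h₁, reassoc_of% h₂]
  h_castSucc_comp_δ_succ_of_lt {n} l j hji := by
    have hl : (j : ℕ) < l := hji
    have := l.2
    rw [Category.assoc, bracketMul_δ (w' := j + 1) _ (by omega)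
      (by rw [if_neg (by simp; omega)]; simp), ← Category.assoc, ← Category.assoc,
      SimplicialObject.δ_comp_σ_of_gt _ hji]
  h_comp_σ_castSucc_of_le {n} l j hij := by
    have hl : (l : ℕ) ≤ j := hij
    have := j.2
    rw [Category.assoc, bracketMul_σ (w' := j + 2) _ (by omega)
      (by rw [if_pos (by simp; omega)]), ← Category.assoc, ← Category.assoc,
      SimplicialObject.σ_comp_σ _ hij]
    rfl
  h_comp_σ_succ_of_lt {n} l j hji := by
    have hl : (j : ℕ) ≤ l := hji
    have := l.2
    rw [Category.assoc, bracketMul_σ (w' := j + 1) _ (by omega)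
      (by rw [if_neg (by simp; omega)]), ← Category.assoc, ← Category.assoc,
      ← SimplicialObject.σ_comp_σ _ hji]
    rfl

end ResolutionElements

/-! ### The path `HH(S) → HH(S[t])` and its two ends -/

section PolynomialPath

open Opposite Simplicial

variable {k R : SimplicialObject CommRingCat.{u}}

/-- The functor `S ↦ S[t]` on simplicial commutative `R`-algebras. -/
noncomputable def polyFunctor (R : SimplicialObject CommRingCat.{u}) : Under R ⥤ Under R where
  obj := poly
  map {S S'} w := Under.homMk (((SimplicialObject.whiskering _ _).obj polyRing).map w.right)
    (NatTrans.ext (funext fun n => by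
      have h : S.hom ≫ w.right = S'.hom := Under.w w
      have h₁ : polyRingC.app _ ≫ polyRing.map (w.right.app n) =
          w.right.app n ≫ polyRingC.app _ := (polyRingC.naturality (w.right.app n)).symm
      have h₂ : S.hom.app n ≫ w.right.app n = S'.hom.app n := congrArg (fun z => z.app n) h
      change (S.hom.app n ≫ polyRingC.app (S.right.obj n)) ≫ polyRing.map (w.right.app n) =
        S'.hom.app n ≫ polyRingC.app (S'.right.obj n)
      rw [Category.assoc, h₁, reassoc_of% h₂]))
  map_id S := Under.UnderMorphism.ext (NatTrans.ext (funext fun _ => polyRing.map_id _))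
  map_comp w w' := Under.UnderMorphism.ext (NatTrans.ext (funext fun _ => polyRing.map_comp _ _))

noncomputable def polyUnit (R : SimplicialObject CommRingCat.{u}) : 𝟭 (Under R) ⟶ polyFunctor R where
  app S := polyIncl S
  naturality _ _ w :=
    Under.UnderMorphism.ext (NatTrans.ext (funext fun n => polyRingC.naturality (w.right.app n)))

/-- The evaluation `A[t] → A` at an integer. -/
noncomputable def polyRingEval (c : ℤ) : polyRing.{u} ⟶ 𝟭 CommRingCat.{u} where
  app A := CommRingCat.ofHom (Polynomial.evalRingHom (c : A))
  naturality A A' f := by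
    ext p
    exact Polynomial.eval_intCast_map f.hom p c

lemma polyRingC_eval (c : ℤ) : polyRingC.{u} ≫ polyRingEval c = 𝟙 _ := by
  ext A x
  exact Polynomial.eval_C

/-- The evaluation `S[t] → S` at an integer. -/
noncomputable def polyEval (R : SimplicialObject CommRingCat.{u}) (c : ℤ) :
    polyFunctor R ⟶ 𝟭 (Under R) where
  app S := Under.homMk (Functor.whiskerLeft S.right (polyRingEval c)) 
    (NatTrans.ext (funext fun n => by
      have h : polyRingC.app (S.right.obj n) ≫ (polyRingEval c).app (S.right.obj n) = 𝟙 _ :=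
        congrArg (fun z => z.app (S.right.obj n)) (polyRingC_eval c)
      change (S.hom.app n ≫ polyRingC.app (S.right.obj n)) ≫
        (polyRingEval c).app (S.right.obj n) = S.hom.app n
      rw [Category.assoc, h]
      exact Category.comp_id _))
  naturality _ _ w := Under.UnderMorphism.ext
    (NatTrans.ext (funext fun n => (polyRingEval c).naturality (w.right.app n)))

lemma polyUnit_eval (R : SimplicialObject CommRingCat.{u}) (c : ℤ) :
    polyUnit R ≫ polyEval R c = 𝟙 _ :=
  NatTrans.ext (funext fun S => Under.UnderMorphism.ext (NatTrans.ext (funext fun n =>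
    congrArg (fun z => z.app (S.right.obj n)) (polyRingC_eval c))))

/-- The element `[⋯[t]⋯]` of the resolution of `S[t]`. -/
noncomputable def nestedT (φ : k ⟶ R) (S : Under R) (n : SimplexCategoryᵒᵖ) :
    (((resolution φ).obj (poly S)).obj n).right :=
  nestedVar (A := (structureArrow φ (poly S)).obj n)
    (Polynomial.X : Polynomial (S.right.obj n)) (n.unop.len + 1)

variable {φ : k ⟶ R}

lemma resolution_map_nestedT (S : Under R) {m n : SimplexCategoryᵒᵖ} (θ : m ⟶ n) :
    (((resolution φ).obj (poly S)).map θ).right.hom (nestedT φ S m) = nestedT φ S n := by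
  refine (resolution_map_nestedVar θ _).trans ?_
  exact congrArg (fun z => nestedVar (A := (structureArrow φ (poly S)).obj n) z (n.unop.len + 1))
    (Polynomial.map_X (S.right.map θ).hom)

lemma resolution_app_nestedT {S S' : Under R} (v : S ⟶ S') (n : SimplexCategoryᵒᵖ) :
    (((resolution φ).map ((polyFunctor R).map v)).app n).right.hom (nestedT φ S n) =
      nestedT φ S' n := by
  refine (resolution_app_nestedVar ((polyFunctor R).map v) _).trans ?_
  exact congrArg (fun z => nestedVar (A := (structureArrow φ (poly S')).obj n) z (n.unop.len + 1))
    (Polynomial.map_X (v.right.app n).hom)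

lemma resolution_eval_nestedT (c : ℤ) (S : Under R) (n : SimplexCategoryᵒᵖ) :
    (((resolution φ).map ((polyEval R c).app S)).app n).right.hom (nestedT φ S n) =
      bracketed ((structureArrow φ S).obj n) c (n.unop.len + 1) (n.unop.len + 1) := by
  refine (resolution_app_nestedVar ((polyEval R c).app S) _).trans ?_
  rw [bracketed_self]
  exact congrArg (fun z => nestedVar (A := (structureArrow φ S).obj n) z (n.unop.len + 1))
    Polynomial.eval_X

variable (φ)

/-- The functoriality of `hochRes`. -/
noncomputable def hochResMap {S S' : Under R} (v : S ⟶ S') (i : ℕ) :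
    hochRes φ S i ⟶ hochRes φ S' i :=
  ((SimplicialObject.whiskering _ _).obj (hoch i)).map ((resolution φ).map v)

/-- The Hochschild differential on `hochRes`. -/
noncomputable def hochResB (S : Under R) (i : ℕ) : hochRes φ S (i + 1) ⟶ hochRes φ S i :=
  ((SimplicialObject.whiskering _ _).map (hochB i)).app ((resolution φ).obj S)

/-- The common form of the naturality checks for the path and for the homotopy: a commutative
square, together with a compatible choice of the element to multiply by. -/
lemma map_hochMul_map (i : ℕ) {f g f' g' : Arrow CommRingCat.{u}} (a : f ⟶ g) (b : g ⟶ g')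
    (c : f ⟶ f') (d : f' ⟶ g') (e : a ≫ b = c ≫ d) {q : g.right} {q' : g'.right}
    (hq : b.right.hom q = q') : ((hoch i).map a ≫ hochMul i g q) ≫ (hoch i).map b =
      (hoch i).map c ≫ (hoch i).map d ≫ hochMul i g' q' := by
  rw [Category.assoc, hochMul_naturality, hq, ← Functor.map_comp_assoc, e,
    Functor.map_comp_assoc]

lemma map_hochMul_hochB (i : ℕ) {f g : Arrow CommRingCat.{u}} (a : f ⟶ g) (q : g.right) :
    ((hoch (i + 1)).map a ≫ hochMul (i + 1) g q) ≫ (hochB i).app g =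
      (hochB i).app f ≫ (hoch i).map a ≫ hochMul i g q := by
  rw [Category.assoc, hochMul_hochB, NatTrans.naturality_assoc]

/-- The composition of `S → S[t]` with the multiplication by `t`, on Hochschild chains. -/
noncomputable def hochPath (S : Under R) (i : ℕ) : hochRes φ S i ⟶ hochRes φ (poly S) i where
  app n := (hoch i).map (((resolution φ).map (polyIncl S)).app n) ≫
    hochMul i (((resolution φ).obj (poly S)).obj n) (nestedT φ S n)
  naturality _ _ θ := (map_hochMul_map i _ _ _ _
    (((resolution φ).map (polyIncl S)).naturality θ).symm (resolution_map_nestedT S θ)).symm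

lemma hochPath_B (S : Under R) (i : ℕ) :
    hochPath φ S (i + 1) ≫ hochResB φ (poly S) i = hochResB φ S i ≫ hochPath φ S i :=
  NatTrans.ext (funext fun _ => map_hochMul_hochB i _ _)

lemma hochPath_naturality {S S' : Under R} (v : S ⟶ S') (i : ℕ) :
    hochPath φ S i ≫ hochResMap φ ((polyFunctor R).map v) i =
      hochResMap φ v i ≫ hochPath φ S' i := by
  have h : (resolution φ).map (polyIncl S) ≫ (resolution φ).map ((polyFunctor R).map v) =
      (resolution φ).map v ≫ (resolution φ).map (polyIncl S') :=
    ((resolution φ).map_comp _ _).symm.trans ((congrArg (resolution φ).map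
      ((polyUnit R).naturality v).symm).trans ((resolution φ).map_comp _ _))
  exact NatTrans.ext (funext fun n =>
    map_hochMul_map i _ _ _ _ (congrArg (fun z => z.app n) h) (resolution_app_nestedT v n))

/-- Each evaluation retracts `S → S[t]`, so only the multiplication by the value of `[⋯[t]⋯]` at `c`
remains. -/
lemma hochPath_eval (S : Under R) (i : ℕ) :
    hochPath φ S i ≫ hochResMap φ ((polyEval R 1).app S) i -
      hochPath φ S i ≫ hochResMap φ ((polyEval R 0).app S) i = bracketEnd φ S i := by
  have key : ∀ (c : ℤ) n, (hochPath φ S i ≫ hochResMap φ ((polyEval R c).app S) i).app n =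
      hochMul i (((resolution φ).obj S).obj n)
        (bracketed ((structureArrow φ S).obj n) c (n.unop.len + 1) (n.unop.len + 1)) := by
    intro c n
    have h : (resolution φ).map (polyIncl S) ≫ (resolution φ).map ((polyEval R c).app S) =
        𝟙 _ ≫ 𝟙 _ :=
      ((resolution φ).map_comp _ _).symm.trans ((congrArg (resolution φ).map
        (congrArg (fun z => z.app S) (polyUnit_eval R c))).trans
          (((resolution φ).map_id _).trans (Category.comp_id _).symm))
    refine (map_hochMul_map i _ _ _ _ (congrArg (fun z => z.app n) h)
      (resolution_eval_nestedT c S n)).trans ?_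
    have h' : ∀ {f : Arrow CommRingCat.{u}} (z : (hoch i).obj f ⟶ (hoch i).obj f),
        (hoch i).map (𝟙 f) ≫ (hoch i).map (𝟙 f) ≫ z = z := fun z => by
      rw [CategoryTheory.Functor.map_id, Category.id_comp, Category.id_comp]
    exact h' (f := ((resolution φ).obj S).obj n) _
  exact NatTrans.ext (funext fun n => (congrArg₂ (· - ·) (key 1 n) (key 0 n)).trans
    (hochMul_sub i (((resolution φ).obj S).obj n) _ _).symm)

end PolynomialPath

/-! ### From the simplicial homotopy to the total complex -/

section TotalHomotopy

open Opposite Simplicial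

variable {k R : SimplicialObject CommRingCat.{u}} {φ : k ⟶ R}

lemma bracketHomotopy_h_B (S : Under R) (i n : ℕ) (j : Fin (n + 1)) :
    (bracketHomotopy φ S (i + 1)).h j ≫ (hochResB φ S i).app (op ⦋n + 1⦌) =
      (hochResB φ S i).app (op ⦋n⦌) ≫ (bracketHomotopy φ S i).h j :=
  map_hochMul_hochB i (((resolution φ).obj S).σ j) (bracketDiff φ S (j + 1) (op ⦋n + 1⦌))

lemma bracketHomotopy_h_naturality {S S' : Under R} (v : S ⟶ S') (i n : ℕ) (j : Fin (n + 1)) :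
    (bracketHomotopy φ S i).h j ≫ (hochResMap φ v i).app (op ⦋n + 1⦌) =
      (hochResMap φ v i).app (op ⦋n⦌) ≫ (bracketHomotopy φ S' i).h j :=
  map_hochMul_map i _ _ _ _ (((resolution φ).map v).naturality _)
    (resolution_app_bracketDiff v (j + 1) (op ⦋n + 1⦌))

variable (φ)

/-- The chain homotopy between the identity and the multiplication by `[⋯[1]⋯] - [⋯[0]⋯]`. -/
noncomputable def contraction (S : Under R) (i j : ℕ) :
    (hochRes φ S i).obj (op ⦋j⦌) ⟶ (hochRes φ S i).obj (op ⦋j + 1⦌) :=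
  SimplicialObject.Homotopy.ToChainHomotopy.hom (bracketHomotopy φ S i) j (j + 1)

lemma contraction_eq (S : Under R) (i j : ℕ) : contraction φ S i j =
    -∑ l : Fin (j + 1), ((-1 : ℤ) ^ (l : ℕ)) • (bracketHomotopy φ S i).h l :=
  SimplicialObject.Homotopy.ToChainHomotopy.hom_eq _ _

/-- The homotopy consists of degeneracies of the resolution and multiplications on the zeroth
factor; `b` commutes with both. -/
lemma contraction_B (S : Under R) (i j : ℕ) :
    contraction φ S (i + 1) j ≫ (hochResB φ S i).app (op ⦋j + 1⦌) =
      (hochResB φ S i).app (op ⦋j⦌) ≫ contraction φ S i j := by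
  simp only [contraction_eq, Preadditive.neg_comp, Preadditive.comp_neg, Preadditive.sum_comp,
    Preadditive.comp_sum, Preadditive.zsmul_comp, Preadditive.comp_zsmul, bracketHomotopy_h_B]

lemma contraction_naturality {S S' : Under R} (v : S ⟶ S') (i j : ℕ) :
    contraction φ S i j ≫ (hochResMap φ v i).app (op ⦋j + 1⦌) =
      (hochResMap φ v i).app (op ⦋j⦌) ≫ contraction φ S' i j := by
  simp only [contraction_eq, Preadditive.neg_comp, Preadditive.comp_neg, Preadditive.sum_comp,
    Preadditive.comp_sum, Preadditive.zsmul_comp, Preadditive.comp_zsmul,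
    bracketHomotopy_h_naturality]

variable {φ}

/-- A map of simplicial groups in a fixed degree. -/
noncomputable def resOp {S S' : Under R} {i i' : ℕ} (F : hochRes φ S i ⟶ hochRes φ S' i') (j : ℕ) :
    Chains φ S i j →+ Chains φ S' i' j :=
  (F.app (op ⦋j⦌)).hom

lemma resOp_D {S S' : Under R} {i : ℕ} (F : hochRes φ S i ⟶ hochRes φ S' i) (j : ℕ)
    (x : Chains φ S i (j + 1)) :
    resOp F j (chainsD φ S i j x) = chainsD φ S' i j (resOp F (j + 1) x) :=
  congrArg (fun z => z.hom x)
    (((AlgebraicTopology.alternatingFaceMapComplex AddCommGrpCat.{u + 1}).map F).comm (j + 1) j).symm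

lemma resOp_B {S S' : Under R} {F : ∀ i, hochRes φ S i ⟶ hochRes φ S' i}
    (hF : ∀ i, F (i + 1) ≫ hochResB φ S' i = hochResB φ S i ≫ F i) (i j : ℕ)
    (x : Chains φ S (i + 1) j) :
    resOp (F i) j (chainsOp φ (hochB i) S j x) =
      chainsOp φ (hochB i) S' j (resOp (F (i + 1)) j x) :=
  congrArg (fun z => (z.app (op ⦋j⦌)).hom x) (hF i).symm

variable (φ) in
/-- The components of `contraction`. -/
noncomputable def contract (S : Under R) (i j : ℕ) : Chains φ S i j →+ Chains φ S i (j + 1) :=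
  (contraction φ S i j).hom

lemma contract_B {S : Under R} (i j : ℕ) (x : Chains φ S (i + 1) j) :
    contract φ S i j (chainsOp φ (hochB i) S j x) =
      chainsOp φ (hochB i) S (j + 1) (contract φ S (i + 1) j x) :=
  congrArg (fun z => z.hom x) (contraction_B φ S i j).symm

lemma contract_naturality {S S' : Under R} (v : S ⟶ S') (i j : ℕ) (x : Chains φ S i j) :
    chainsMap φ v i (j + 1) (contract φ S i j x) = contract φ S' i j (chainsMap φ v i j x) :=
  congrArg (fun z => z.hom x) (contraction_naturality φ v i j)

lemma contract_comm_zero (S : Under R) (i : ℕ) (x : Chains φ S i 0) :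
    resOp (bracketEnd φ S i) 0 x = chainsD φ S i 0 (contract φ S i 0 x) + x := by
  have h := (bracketHomotopy φ S i).toChainHomotopy.comm 0
  rw [prevD_eq _ (show (ComplexShape.down ℕ).Rel 1 0 from rfl), dNext_eq_zero _ _ (by simp),
    zero_add] at h
  exact congrArg (fun z => z.hom x) h

lemma contract_comm_succ (S : Under R) (i j : ℕ) (x : Chains φ S i (j + 1)) :
    resOp (bracketEnd φ S i) (j + 1) x = contract φ S i j (chainsD φ S i j x) +
      chainsD φ S i (j + 1) (contract φ S i (j + 1) x) + x := by
  have h := (bracketHomotopy φ S i).toChainHomotopy.comm (j + 1)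
  rw [prevD_eq _ (show (ComplexShape.down ℕ).Rel (j + 2) (j + 1) from rfl),
    dNext_eq _ (show (ComplexShape.down ℕ).Rel (j + 1) j from rfl)] at h
  exact congrArg (fun z => z.hom x) h

/-- With only `u^p` present, `uB` lands in the discarded power `u^(p+1)`. Hence the path and the
contraction need not commute with `B`. -/
lemma cycD_singleton {p n : ℤ} {S : Under R} (x : cycGroup φ {p} n S) {i j : ℕ}
    (h : InRange {p} (n + 1) i j) : (cycD φ {p} n S x).1 i j =
      chainsOp φ (hochB i) S j (x.1 (i + 1) j) +
        (-1 : ℤ) ^ i • chainsD φ S i j (x.1 i (j + 1)) := by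
  have hc : connesPart φ S x.1 i j = 0 := by
    cases i with
    | zero => rfl
    | succ i =>
      refine (congrArg (chainsOp φ (connesB i) S j) (x.2 i j ?_)).trans (map_zero _)
      rintro ⟨q, hq, e⟩
      obtain ⟨q', hq', e'⟩ := h
      rw [Set.mem_singleton_iff] at hq hq'
      push_cast at e'
      omega
  rw [cycD_apply x h, totalD, hc, add_zero]

/-- The map of cyclic complexes induced by a family of maps of chains. -/
noncomputable def cycOf {S S' : Under R} (F : ∀ i, hochRes φ S i ⟶ hochRes φ S' i) (I : Set ℤ)
    (n : ℤ) : cycGroup φ I n S →+ cycGroup φ I n S' where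
  toFun x := ⟨fun i j => resOp (F i) j (x.1 i j), fun i j h => by
    change resOp (F i) j (x.1 i j) = 0
    rw [x.2 i j h, map_zero]⟩
  map_zero' := cycGroup_ext fun i j => map_zero (resOp (F i) j)
  map_add' _ _ := cycGroup_ext fun i j => map_add (resOp (F i) j) _ _

lemma cycOf_apply {S S' : Under R} (F : ∀ i, hochRes φ S i ⟶ hochRes φ S' i) {I : Set ℤ}
    {n : ℤ} (x : cycGroup φ I n S) (i j : ℕ) : (cycOf F I n x).1 i j = resOp (F i) j (x.1 i j) :=
  rfl

lemma cycD_cycOf {S S' : Under R} {F : ∀ i, hochRes φ S i ⟶ hochRes φ S' i}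
    (hF : ∀ i, F (i + 1) ≫ hochResB φ S' i = hochResB φ S i ≫ F i) (p n : ℤ)
    (x : cycGroup φ {p} n S) :
    cycD φ {p} n S' (cycOf F {p} n x) = cycOf F {p} (n + 1) (cycD φ {p} n S x) := by
  refine cycGroup_ext fun i j => ?_
  by_cases h : InRange {p} (n + 1) i j
  · rw [cycD_singleton _ h, cycOf_apply, cycOf_apply, cycOf_apply, cycD_singleton _ h, map_add,
      map_zsmul, resOp_D, resOp_B hF]
  · rw [cycGroup_eq_zero _ h, cycGroup_eq_zero _ h]

variable (φ)

/-- The signed contractions, as maps on a cyclic complex. -/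
noncomputable def cycContraction (I : Set ℤ) {n m : ℤ} (h : m + 1 = n) (S : Under R) :
    cycGroup φ I n S →+ cycGroup φ I m S where
  toFun x := ⟨fun i j => match j with
    | 0 => 0
    | j + 1 => (-1 : ℤ) ^ i • contract φ S i j (x.1 i j), fun i j h' => by
      subst h
      cases j with
      | zero => rfl
      | succ j =>
        have : x.1 i j = 0 := x.2 i j fun hx => h' (by
          obtain ⟨p, hp, e⟩ := hx
          exact ⟨p, hp, by push_cast; linarith⟩)
        change (-1 : ℤ) ^ i • contract φ S i j (x.1 i j) = 0
        rw [this, map_zero, smul_zero]⟩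
  map_zero' := cycGroup_ext fun i j => by
    cases j with
    | zero => rfl
    | succ j =>
      change (-1 : ℤ) ^ i • contract φ S i j 0 = 0
      rw [map_zero, smul_zero]
  map_add' x y := cycGroup_ext fun i j => by
    cases j with
    | zero => exact (add_zero _).symm
    | succ j =>
      change (-1 : ℤ) ^ i • contract φ S i j (x.1 i j + y.1 i j) =
        (-1 : ℤ) ^ i • contract φ S i j (x.1 i j) + (-1 : ℤ) ^ i • contract φ S i j (y.1 i j)
      rw [map_add, smul_add]

variable {φ}

lemma cycContraction_zero {I : Set ℤ} {n m : ℤ} (h : m + 1 = n) {S : Under R}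
    (x : cycGroup φ I n S) (i : ℕ) : (cycContraction φ I h S x).1 i 0 = 0 := rfl

lemma cycContraction_succ {I : Set ℤ} {n m : ℤ} (h : m + 1 = n) {S : Under R}
    (x : cycGroup φ I n S) (i j : ℕ) : (cycContraction φ I h S x).1 i (j + 1) =
      (-1 : ℤ) ^ i • contract φ S i j (x.1 i j) := rfl

lemma cycContraction_comm (p m : ℤ) {S : Under R} (x : cycGroup φ {p} (m + 1) S) :
    cycOf (bracketEnd φ S) {p} (m + 1) x =
      cycContraction φ {p} rfl S (cycD φ {p} (m + 1) S x) +
        cycD φ {p} m S (cycContraction φ {p} rfl S x) + x := by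
  refine cycGroup_ext fun i j => ?_
  by_cases h : InRange {p} (m + 1) i j
  swap
  · rw [cycGroup_eq_zero _ h, cycGroup_eq_zero _ h]
  -- The sign of the contraction cancels the sign of `d` in the total differential, while its change
  -- from `i` to `i + 1` makes the two terms with `b` cancel.
  have sq : ∀ {A : Type (u + 1)} [AddCommGroup A] (a : A), (-1 : ℤ) ^ i • (-1 : ℤ) ^ i • a = a :=
    fun a => by rw [smul_smul, ← mul_pow, neg_one_mul, neg_neg, one_pow, one_smul]
  change resOp (bracketEnd φ S i) j (x.1 i j) =
    (cycContraction φ {p} rfl S (cycD φ {p} (m + 1) S x)).1 i j +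
      (cycD φ {p} m S (cycContraction φ {p} rfl S x)).1 i j + x.1 i j
  rw [cycD_singleton _ h, cycContraction_succ, map_zsmul, sq]
  cases j with
  | zero =>
    rw [cycContraction_zero, cycContraction_zero, map_zero, zero_add, zero_add]
    exact contract_comm_zero S i _
  | succ j =>
    rw [cycContraction_succ, cycContraction_succ, cycD_singleton _ (inRange_d' h), map_add,
      map_zsmul, map_zsmul, smul_add, sq, contract_B, pow_succ, mul_neg_one, neg_smul,
      contract_comm_succ S i j]
    abel

variable (φ)

lemma cycContraction_naturality {I : Set ℤ} {n m : ℤ} (h : m + 1 = n) {S S' : Under R} (v : S ⟶ S')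
    (x : cycGroup φ I n S) :
    cycMap I m v (cycContraction φ I h S x) = cycContraction φ I h S' (cycMap I n v x) := by
  refine cycGroup_ext fun i j => ?_
  cases j with
  | zero => exact map_zero (chainsMap φ v i 0)
  | succ j =>
    change chainsMap φ v i (j + 1) ((-1 : ℤ) ^ i • contract φ S i j (x.1 i j)) =
      (-1 : ℤ) ^ i • contract φ S' i j (chainsMap φ v i j (x.1 i j))
    rw [map_zsmul, contract_naturality]

/-- `cycContraction` as a map of functors. -/
noncomputable def cycContractionObj (I : Set ℤ) {n m : ℤ} (h : m + 1 = n) :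
    cycObj φ I n ⟶ cycObj φ I m where
  app S := AddCommGrpCat.ofHom (cycContraction φ I h S)
  naturality S S' v := by
    ext x
    exact (cycContraction_naturality φ h v x).symm

/-- The map `HH(S) → HH(S[t])` given by the multiplication by `t`. -/
noncomputable def cycPath (p : ℤ) :
    cycComplex φ {p} ⟶ (precomp (polyFunctor R)).obj (cycComplex φ {p}) where
  f n :=
    { app S := AddCommGrpCat.ofHom (cycOf (hochPath φ S) {p} n)
      naturality S S' v := by
        ext x
        refine cycGroup_ext fun i j => ?_
        exact congrArg (fun z => (z.app (op ⦋j⦌)).hom (x.1 i j)) (hochPath_naturality φ v i).symm }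
  comm' n m hnm := by
    obtain rfl : n + 1 = m := hnm
    refine NatTrans.ext (funext fun S => ?_)
    change AddCommGrpCat.ofHom (cycOf (hochPath φ S) {p} n) ≫
      ((cycComplex φ {p}).d n (n + 1)).app (poly S) = ((cycComplex φ {p}).d n (n + 1)).app S ≫
        AddCommGrpCat.ofHom (cycOf (hochPath φ S) {p} (n + 1))
    rw [cycComplex_d]
    ext x
    exact cycD_cycOf (hochPath_B φ S) p n x

variable {φ} in
lemma cycPathHomotopy_comm (p m : ℤ) :
    (cycPath φ p ≫ precompCounit (polyEval R 1) _ -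
        cycPath φ p ≫ precompCounit (polyEval R 0) _).f (m + 1) =
      cycDiff φ {p} (m + 1) ≫ cycContractionObj φ {p} rfl +
        cycContractionObj φ {p} rfl ≫ cycDiff φ {p} m + 𝟙 (cycObj φ {p} (m + 1)) := by
  refine NatTrans.ext (funext fun S => ?_)
  ext x
  refine Eq.trans ?_ (cycContraction_comm p m x)
  refine cycGroup_ext fun i j => ?_
  exact congrArg (fun z => (z.app (op ⦋j⦌)).hom (x.1 i j)) (hochPath_eval φ S i)

/-- The difference of the ends of `cycPath` is homotopic to the identity. -/
noncomputable def cycPathHomotopy (p : ℤ) :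
    Homotopy (cycPath φ p ≫ precompCounit (polyEval R 1) _ -
      cycPath φ p ≫ precompCounit (polyEval R 0) _) (𝟙 (cycComplex φ {p})) where
  hom n m := if h : m + 1 = n then cycContractionObj φ {p} h else 0
  zero n m h := dif_neg h
  comm n := by
    -- With the degree written as a successor, the degree equations in the homotopy hold by `rfl`.
    obtain ⟨m, rfl⟩ : ∃ m, n = m + 1 := ⟨n - 1, by ring⟩
    rw [dNext_eq _ (show (ComplexShape.up ℤ).Rel (m + 1) (m + 1 + 1) from rfl),
      prevD_eq _ (show (ComplexShape.up ℤ).Rel m (m + 1) from rfl)]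
    refine (cycPathHomotopy_comm p m).trans (congrArg (· + 𝟙 (cycObj φ {p} (m + 1))) ?_)
    refine congrArg₂ (fun a b : cycObj φ {p} (m + 1) ⟶ cycObj φ {p} (m + 1) => a + b)
      (congrArg₂ (fun a b => a ≫ b) (cycComplex_d φ {p} (m + 1)).symm (dif_pos rfl).symm)
      (congrArg₂ (fun a b => a ≫ b) (dif_pos rfl).symm (cycComplex_d φ {p} m).symm)

end TotalHomotopy

/-! ### Maps out of a distinguished triangle -/

section Triangles

open Pretriangulated

universe w₁ w₂

/-- The maps to `G` are insensitive to a map whose cone has no maps to `G` and `G⟦1⟧`. -/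
lemma bijective_mor₁_comp {C : Type w₁} [Category.{w₂} C] [Preadditive C] [HasZeroObject C]
    [HasShift C ℤ] [∀ n : ℤ, (shiftFunctor C n).Additive] [Pretriangulated C] {T : Triangle C}
    (hT : T ∈ distTriang C) {G : C} (h₀ : ∀ f : T.obj₃ ⟶ G, f = 0)
    (h₁ : ∀ f : T.obj₃ ⟶ G⟦(1 : ℤ)⟧, f = 0) :
    Function.Bijective fun g : T.obj₂ ⟶ G => T.mor₁ ≫ g := by
  constructor
  · intro a b hab
    have hab' : T.mor₁ ≫ (a - b) = 0 := (Preadditive.comp_sub _ _ _).trans (sub_eq_zero.2 hab)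
    obtain ⟨g, hg⟩ := Triangle.yoneda_exact₂ _ hT (a - b) hab'
    rw [h₀ g, comp_zero] at hg
    exact sub_eq_zero.1 hg
  · intro a
    -- After two rotations the second map is `-T.mor₁⟦1⟧'`, so exactness extends `a⟦1⟧'` over it.
    -- This is the origin of the sign in the preimage `-b`.
    have hT' := rot_of_distTriang _ (rot_of_distTriang _ hT)
    obtain ⟨g, hg⟩ : ∃ g : T.obj₂⟦(1 : ℤ)⟧ ⟶ G⟦(1 : ℤ)⟧, a⟦(1 : ℤ)⟧' = (-T.mor₁⟦(1 : ℤ)⟧') ≫ g :=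
      Triangle.yoneda_exact₂ _ hT' (a⟦(1 : ℤ)⟧') (h₁ (T.mor₃ ≫ a⟦(1 : ℤ)⟧'))
    obtain ⟨b, rfl⟩ := (shiftFunctor C (1 : ℤ)).map_surjective g
    refine ⟨-b, (shiftFunctor C (1 : ℤ)).map_injective ?_⟩
    change (shiftFunctor C (1 : ℤ)).map (T.mor₁ ≫ (-b)) = _
    rw [hg, Functor.map_comp, Functor.map_neg, Preadditive.comp_neg, Preadditive.neg_comp]

end Triangles

/-! ### Vanishing for `HH` and `HC`, and the map `can` -/

section Vanishing

open DerivedCategory Pretriangulated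

variable {k R : SimplicialObject CommRingCat.{u}} (φ : k ⟶ R)

/-- There are no maps from the shifts of `HH` to `𝔸¹`-invariant presheaves. -/
lemma hom_singleton_eq_zero (p : ℤ) {G : DPsh R} (hG : Inverts (polyUnit R) G)
    (f : Q.obj (cycComplex φ {p}) ⟶ G) : f = 0 :=
  hG.eq_zero_of_path (polyUnit_eval R 0) (polyUnit_eval R 1) (cycPath φ p) (cycPathHomotopy φ p) f

/-- The coefficient of `u^q` has chain degree `2q - n`, which is negative for all `q ≤ p`. -/
lemma isZero_cycObj_Iic {p n : ℤ} (h : 2 * p < n) : IsZero (cycObj φ (Set.Iic p) n) := by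
  refine Functor.isZero _ fun S => ?_
  have : Subsingleton (cycGroup φ (Set.Iic p) n S) := ⟨fun x y => cycGroup_ext fun i j => by
    have h' : ¬ InRange (Set.Iic p) n i j := by
      rintro ⟨q, hq, e⟩
      have := Set.mem_Iic.1 hq
      omega
    rw [x.2 i j h', y.2 i j h']⟩
  exact AddCommGrpCat.isZero_of_subsingleton (AddCommGrpCat.of (cycGroup φ (Set.Iic p) n S))

/-- There are no maps from the shifts of `HC` to `𝔸¹`-invariant presheaves. -/
lemma hom_Iic_eq_zero (p : ℤ) {G : DPsh R} (hG : Inverts (polyUnit R) G)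
    (f : Q.obj (cycComplex φ (Set.Iic p)) ⟶ G) : f = 0 := by
  let X : ℕ → CochainComplex (AbPsh R) ℤ := fun n => cycComplex φ (Set.Iic (p - n))
  have hI : ∀ q : ℤ, {q} ⊆ Set.Iic q := fun q => Set.singleton_subset_iff.2 Set.self_mem_Iic
  have hK : ∀ (n : ℕ) (q : ℤ), q ∈ Set.Iic (p - (n + 1 : ℕ)) ↔
      q ∈ Set.Iic (p - n) ∧ q ∉ ({p - (n : ℤ)} : Set ℤ) := fun n q => by
    simp only [Set.mem_Iic, Set.mem_singleton_iff]
    omega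
  have hup : ∀ (n : ℕ), ∀ q ∈ ({p - (n : ℤ)} : Set ℤ), q + 1 ∈ Set.Iic (p - (n : ℤ)) →
      q + 1 ∈ ({p - (n : ℤ)} : Set ℤ) := fun n q hq hq' => by
    simp only [Set.mem_Iic, Set.mem_singleton_iff] at hq hq' ⊢
    omega
  -- The top power of `u` spans a subcomplex because `uB` raises powers; `s n` is the quotient by
  -- it.
  let s : ∀ n, X n ⟶ X (n + 1) := fun n => transferComplex (.of_quot (hK n) (hup n))
  have hX : ∀ m : ℤ, ∃ N, ∀ n, N ≤ n → IsZero ((X n).X m) := fun m =>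
    ⟨(2 * p - m).toNat + 1, fun n hn => isZero_cycObj_Iic φ (by omega)⟩
  -- The kernel of `s n` is a shift of `HH`, so maps to `G` vanish on it and factor through the
  -- quotient.
  have key : ∀ f : Q.obj (X 0) ⟶ G, f = 0 := eq_zero_of_telescope (S := s) hX fun n f => by
    obtain ⟨w, h⟩ := exists_shortExact φ (hI (p - n)) (hK n) (hup n)
    exact Triangle.yoneda_exact₂ _ (triangleOfSES_distinguished h) f
      (hom_singleton_eq_zero φ (p - n) hG _)
  have h0 : Set.Iic p = Set.Iic (p - (0 : ℕ)) := by simp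
  revert f
  rw [h0]
  exact key

lemma canComplex_eq (h : IsTransfer (Set.Ici 0) Set.univ) :
    canComplex φ = transferComplex h := by
  ext n : 1
  refine NatTrans.ext (funext fun S => ?_)
  ext x
  exact cycGroup_ext fun i j => (transfer_apply_of_subset (Set.subset_univ _) x i j).symm

lemma inverts_of_isA1Invariant {G : DPsh R} (hG : IsA1Invariant R G) : Inverts (polyUnit R) G :=
  hG.2

/-- The zero object has zero cohomology and is thus invariant, so only the absence of maps from `X`
to invariant objects matters. -/
lemma isA1Localization_zero {X : DPsh R}
    (h : ∀ {G : DPsh R}, Inverts (polyUnit R) G → ∀ f : X ⟶ G, f = 0) :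
    IsA1Localization (0 : X ⟶ 0) where
  invariant := by
    have hz : ∀ (n : ℤ) (S : Under R), IsZero (((homologyFunctor (AbPsh R) n).obj 0).obj S) :=
      fun n S => (((evaluation _ _).obj S).map_isZero
        ((homologyFunctor (AbPsh R) n).map_isZero (isZero_zero _)))
    exact ⟨fun n S S' w _ => (hz n S).isIso (hz n S') _, fun n S => (hz n S).isIso (hz n _) _⟩
  equivalence G hG :=
    ⟨fun a b _ => (isZero_zero _).eq_of_src a b, fun a =>
      ⟨0, (comp_zero).trans (h (inverts_of_isA1Invariant hG) a).symm⟩⟩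

/-- The cokernel consists of the negative powers of `u`, and the vanishing for such ranges is
applied to both `G` and its shift. -/
lemma isA1Equivalence_can : IsA1Equivalence (can φ) := by
  have hI : Set.Ici (0 : ℤ) ⊆ Set.univ := Set.subset_univ _
  have hK : ∀ p : ℤ, p ∈ Set.Iic (-1) ↔ p ∈ Set.univ ∧ p ∉ Set.Ici (0 : ℤ) := fun p => by
    simp only [Set.mem_Iic, Set.mem_univ, Set.mem_Ici, true_and]
    omega
  have hup : ∀ p ∈ Set.Ici (0 : ℤ), p + 1 ∈ Set.univ → p + 1 ∈ Set.Ici (0 : ℤ) := fun p hp _ => by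
    simp only [Set.mem_Ici] at hp ⊢
    omega
  obtain ⟨w, h⟩ := exists_shortExact φ hI hK hup
  have hT := triangleOfSES_distinguished h
  have hcan : can φ = (triangleOfSES h).mor₁ :=
    congrArg (fun z => Q.map z) (canComplex_eq φ (.of_sub hI hup))
  intro G hG
  have hG' := inverts_of_isA1Invariant hG
  rw [hcan]
  exact bijective_mor₁_comp hT (hom_Iic_eq_zero φ (-1) hG') (hom_Iic_eq_zero φ (-1) hG'.shift)

end Vanishing

end A1

theorem mainTheorem7 {k R : SimplicialObject CommRingCat.{u}} (φ : k ⟶ R) :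
    A1.IsA1Localization (0 : A1.HH φ ⟶ 0) ∧
      A1.IsA1Localization (0 : A1.HC φ ⟶ 0) ∧
      A1.IsA1Equivalence (A1.can φ) :=
  ⟨A1.isA1Localization_zero (fun hG => A1.hom_singleton_eq_zero φ 0 hG),
    A1.isA1Localization_zero (fun hG => A1.hom_Iic_eq_zero φ 0 hG), A1.isA1Equivalence_can φ⟩
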